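/- Let $d\ge 1$ be an integer and $\rho\in[0,1)$ with $d\rho^2>1$, both fixed. Let $T_{d,h}$ be the $d$-ary tree of depth $h$; its nodes at level $\ell$ are the words in $[d]^\ell$, ordered lexicographically. In the Ising broadcast process on $T_{d,h}$ the root spin is uniform on $\{-1,+1\}$ and, given the spins at one level, the spins at the next level are independent, each equal to the spin of its parent with probability $\frac{1+\rho}{2}$ and to its negative with probability $\frac{1-\rho}{2}$. For $0\le w\le h$, the leaves of $T_{d,h}$ are divided into the $d^{h-w}$ consecutive leaf blocks, each of size $d^w$, of the subtrees rooted at level $h-w$. The autoregressive process with context depth $w$ generates a configuration $X_L=(Y_1,\dots,Y_{d^{h-w}})\in\{-1,+1\}^{d^h}$ of leaf spins as follows. 1. $Y_1$ has the law of one such block in the Ising broadcast process on $T_{d,h}$. 2. For $r=2,\dots,d^{h-w}$, first sample, independently of everything before, a height $h_r\in\{1,\dots,h-w\}$ distributed as the height (above level $h-w$) of the least common ancestor of a uniformly random pair of adjacent nodes at level $h-w$. Then, given $h_r$ and $Y_1,\dots,Y_{r-1}$, sample $Y_r$ from the conditional law, in the Ising broadcast process, of the right block of a pair of adjacent blocks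 whose roots have their least common ancestor at height exactly $h_r$, given that the left block equals $Y_{r-1}$. Then, as $w\to\infty$ and $h-w\to\infty$, the excess kurtosis of the sum of the generated leaves tends to that of a Gaussian: $$\mathrm{Kurt}\Big(\sum_{i=1}^{d^h}(X_L)_i\Big)-3:=\frac{\mathbb E\big[\big(\sum_{i=1}^{d^h}(X_L)_i\big)^4\big]}{\mathbb E\big[\big(\sum_{i=1}^{d^h}(X_L)_i\big)^2\big]^2}-3=o(1).$$ -/

import Mathlib

open Filter Topology

noncomputable section

namespace TreeBroadcast

/-! ### Finite probability -/

/-- The law of a family of independent random variables, the `i`-th one having law `p i`. -/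
def productLaw {ι α : Type*} [Fintype ι] [DecidableEq ι] [Fintype α] (p : ι → PMF α) :
    PMF (ι → α) :=
  PMF.ofFintype (fun x => ∏ i, p i (x i)) (by
    rw [← Fintype.prod_sum (fun i a => p i a)]
    refine Finset.prod_eq_one fun i _ => ?_
    simpa only [tsum_fintype] using (p i).tsum_coe)

open Classical in
/-- For a pair `(A, B)` with joint law `J`, the conditional law of `B` given `A = a`.
(When `A = a` has probability zero the value is irrelevant; the law of `B` is used.) -/
def condLaw {α β : Type*} (J : PMF (α × β)) (a : α) : PMF β :=
  if h : ∃ x ∈ {x : α × β | x.1 = a}, x ∈ J.support then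
    (J.filter {x : α × β | x.1 = a} h).map Prod.snd
  else J.map Prod.snd

/-- The expectation of a real function on a finite probability space. -/
def expect {Ω : Type*} [Fintype Ω] (p : PMF Ω) (f : Ω → ℝ) : ℝ :=
  ∑ x, (p x).toReal * f x

/-- The excess kurtosis of a (centred) real random variable `S`: `𝔼[S⁴] / 𝔼[S²]² - 3`. -/
def excessKurtosis {Ω : Type*} [Fintype Ω] (p : PMF Ω) (S : Ω → ℝ) : ℝ :=
  expect p (fun x => S x ^ 4) / expect p (fun x => S x ^ 2) ^ 2 - 3

/-! ### The `d`-ary tree -/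

/-- The nodes at level `n` of the `d`-ary tree, written as words of length `n`. -/
abbrev Node (d n : ℕ) : Type := Fin n → Fin d

/-- The nodes at level `n` listed from left to right, i.e. in lexicographic order
(the last letter of the word is the least significant digit in base `d`). -/
def nodeEquiv (d n : ℕ) : Fin (d ^ n) ≃ Node d n :=
  finFunctionFinEquiv.symm.trans (Equiv.arrowCongr Fin.revPerm (Equiv.refl (Fin d)))

/-- The height, above level `n`, of the least common ancestor of two nodes at level `n`: the
least `k` such that the two words have the same prefix of length `n - k`. -/
def lcaHeight {d n : ℕ} (u v : Node d n) : ℕ :=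
  Nat.find (p := fun k => ∀ i : Fin n, (i : ℕ) + k < n → u i = v i)
    ⟨n, fun i hi => absurd hi (by omega)⟩

/-- The values at the leaves of the depth-`w` subtree rooted at the node `u` of level `n`,
in a configuration `X` at the leaves of the tree of depth `n + w`. -/
def subtree {α : Type*} {d n w : ℕ} (X : Node d (n + w) → α) (u : Node d n) : Node d w → α :=
  fun t => X (Fin.append u t)

/-! ### The broadcast process -/

/-- The law of the values at level `h` in the broadcast process on the `d`-ary tree with channel
`κ` and root prior `ν`: given level `ℓ`, the values at the nodes `r` of level `ℓ + 1` are
independent, with law `κ` of the value at the parent `Fin.init r` of `r`. For the tree of depth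
`h` this is the law of the values at the leaves. -/
def broadcast {α : Type*} [Fintype α] (d : ℕ) (κ : α → PMF α) (ν : PMF α) :
    (h : ℕ) → PMF (Node d h → α)
  | 0 => ν.map fun σ _ => σ
  | ℓ + 1 => (broadcast d κ ν ℓ).bind fun X =>
      productLaw fun r : Node d (ℓ + 1) => κ (X (Fin.init r))

/-! ### The autoregressive broadcast process

The tree has depth `n + w`; its leaves are cut into the `d ^ n` leaf sets of the depth-`w`
subtrees, listed from left to right. -/

/-- Joint law of `((H, A), B)`: a pair of adjacent depth-`w` subtrees of the tree of depth `n + w`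
is chosen uniformly at random, independently of the broadcast process. `H` is the height of the
least common ancestor of their roots, `A` and `B` are the values at the leaves of the left and of
the right subtree. -/
def adjacentPairLaw {α : Type*} [Fintype α] (d n w : ℕ) (κ : α → PMF α) (ν : PMF α)
    (hn : 1 < d ^ n) : PMF ((ℕ × (Node d w → α)) × (Node d w → α)) :=
  haveI : Nonempty (Fin (d ^ n - 1)) := ⟨⟨0, by omega⟩⟩
  (PMF.uniformOfFintype (Fin (d ^ n - 1))).bind fun s =>
    let u : Node d n := nodeEquiv d n ⟨s, by omega⟩
    let v : Node d n := nodeEquiv d n ⟨s + 1, by omega⟩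
    (broadcast d κ ν (n + w)).map fun X => ((lcaHeight u v, subtree X u), subtree X v)

/-- The law of the next block given the previous block `y`: sample the height `k` of the least
common ancestor of a random pair of adjacent subtrees, then sample the right subtree from the
broadcast process conditioned on the left subtree being `y` and on the height being `k`. -/
def nextBlock {α : Type*} [Fintype α] (d n w : ℕ) (κ : α → PMF α) (ν : PMF α)
    (hn : 1 < d ^ n) (y : Node d w → α) : PMF (Node d w → α) :=
  ((adjacentPairLaw d n w κ ν hn).map fun x => x.1.1).bind fun k =>
    condLaw (adjacentPairLaw d n w κ ν hn) (k, y)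

/-- The law of the first `m` blocks. The first block is the leftmost subtree of the broadcast
process, and each further block is sampled given only the last one. -/
def blocks {α : Type*} [Fintype α] (d n w : ℕ) [NeZero d] (κ : α → PMF α) (ν : PMF α) :
    (m : ℕ) → m ≤ d ^ n → PMF (Fin m → (Node d w → α))
  | 0, _ => PMF.pure Fin.elim0
  | 1, _ => (broadcast d κ ν (n + w)).map fun X _ => subtree X (fun _ : Fin n => (0 : Fin d))
  | m + 2, hm => (blocks d n w κ ν (m + 1) (by omega)).bind fun Y =>
      (nextBlock d n w κ ν (by omega) (Y (Fin.last m))).map fun y =>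
        Fin.snoc (α := fun _ => Node d w → α) Y y

/-- The autoregressive broadcast process of context depth `w` on the tree of depth `n + w`: the
law of the configuration at the leaves that is obtained by putting the `d ^ n` successive blocks
next to each other. -/
def autoregressive {α : Type*} [Fintype α] (d n w : ℕ) [NeZero d] (κ : α → PMF α) (ν : PMF α) :
    PMF (Node d (n + w) → α) :=
  (blocks d n w κ ν (d ^ n) le_rfl).map fun Y ℓ =>
    Y ((nodeEquiv d n).symm fun i => ℓ (Fin.castAdd w i)) fun j => ℓ (Fin.natAdd n j)

/-! ### The Ising case -/

/-- The Ising channel on `{-1, 1}`: the spin is kept with probability `(1 + ρ) / 2` and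
flipped with probability `(1 - ρ) / 2`. -/
def isingChannel (ρ : ℝ) (hρ : ρ ∈ Set.Icc (0 : ℝ) 1) (σ : ℤˣ) : PMF ℤˣ :=
  PMF.ofFintype
    (fun σ' => ENNReal.ofReal (if σ = σ' then (1 + ρ) / 2 else (1 - ρ) / 2)) (by
      have h0 := hρ.1
      have h1 := hρ.2
      have key : ∀ a b : ℝ, 0 ≤ a → 0 ≤ b → a + b = 1 →
          ENNReal.ofReal a + ENNReal.ofReal b = 1 := fun a b ha hb hab => by
        rw [← ENNReal.ofReal_add ha hb, hab, ENNReal.ofReal_one]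
      rw [UnitsInt.univ, Finset.sum_pair (by decide)]
      rcases Int.units_eq_one_or σ with rfl | rfl
      · rw [if_pos rfl, if_neg (by decide)]
        exact key _ _ (by linarith) (by linarith) (by ring)
      · rw [if_neg (by decide), if_pos rfl]
        exact key _ _ (by linarith) (by linarith) (by ring))

/-- The law of the leaves in the autoregressive Ising broadcast process of context depth `w` on
the tree of depth `n + w`, with uniform root prior. -/
def isingAutoregressive (d n w : ℕ) [NeZero d] (ρ : ℝ) (hρ : ρ ∈ Set.Icc (0 : ℝ) 1) :
    PMF (Node d (n + w) → ℤˣ) :=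
  autoregressive d n w (isingChannel ρ hρ) (PMF.uniformOfFintype ℤˣ)

/-- The sum of the spins of a configuration. -/
def spinSum {ι : Type*} [Fintype ι] (X : ι → ℤˣ) : ℝ := ∑ i, ((X i : ℤ) : ℝ)

end TreeBroadcast

end

/-! Given its root spin `σ`, a block satisfies `𝔼[φ] = even φ + σ * odd φ`. Hence, after averaging
over the random height, the next block given the previous block `y` has mean `even φ + q * M(y) *
odd φ` (`expect_nextBlock`), where `M` is the posterior mean of the root spin and `q = 𝔼[ρ ^ (2H)] ≤
ρ ^ 2`. The past enters only through `M`, and `odd φ = even (φ M)`.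

Let `Z` be the spin sum of a block divided by `(dρ) ^ w`, so that `𝔼[Z M] = 1`, and let `T` be the
sum of the `Z` over the first `k` blocks. The moments `A = 𝔼[T M]`, `V = 𝔼[T ^ 2]`, `B = 𝔼[T ^ 3
M]`, `F = 𝔼[T ^ 4]` then obey a closed affine recursion in `k` (`blockMoment_succ`); moments of odd
total degree vanish by spin flip. In terms of cumulants the leading terms cancel: `B - 3AV` is
contracted by a factor at most `ρ ^ 2 < 1` up to a bounded error, so it stays bounded, and `F - 3V ^
2` then changes by a bounded amount per block (`MomentBounds.succ`). Since `V ≥ k`, the excess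
kurtosis is `O(1/k)` with `k = d ^ (h - w)`.

The constants must not depend on `w`. This is where `dρ ^ 2 > 1` enters: above this threshold `𝔼[Z ^
4]` is bounded in `w` (`exists_evenMean_normalizedSum_pow_four_le`), by a recursive bound on
exponential moments. -/

noncomputable section

namespace TreeBroadcast

/-! ### Expectations on finite probability spaces. -/

section Expectation

variable {Ω Ω' : Type*} [Fintype Ω] [Fintype Ω']

theorem sum_toReal (p : PMF Ω) : ∑ x, (p x).toReal = 1 := by
  rw [← ENNReal.toReal_sum fun x _ => p.apply_ne_top x,
    ← tsum_fintype (L := .unconditional _), p.tsum_coe, ENNReal.toReal_one]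

theorem toReal_bind {β : Type*} (p : PMF Ω) (k : Ω → PMF β) (y : β) :
    (p.bind k y).toReal = expect p fun x => (k x y).toReal := by
  rw [PMF.bind_apply, tsum_fintype, ENNReal.toReal_sum]
  · simp [expect, ENNReal.toReal_mul]
  · exact fun x _ => ENNReal.mul_ne_top (p.apply_ne_top x) ((k x).apply_ne_top y)

open Classical in
theorem toReal_map {β : Type*} (p : PMF Ω) (g : Ω → β) (y : β) :
    (p.map g y).toReal = expect p fun x => if y = g x then 1 else 0 := by
  rw [PMF.map, toReal_bind]
  congr 1
  ext x
  simp only [Function.comp, PMF.pure_apply]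
  split_ifs <;> simp

theorem expect_bind (p : PMF Ω) (k : Ω → PMF Ω') (f : Ω' → ℝ) :
    expect (p.bind k) f = expect p fun x => expect (k x) f := by
  simp only [expect, toReal_bind, Finset.sum_mul, Finset.mul_sum]
  rw [Finset.sum_comm]
  simp only [mul_assoc]

theorem expect_pure (x : Ω) (f : Ω → ℝ) : expect (PMF.pure x) f = f x := by
  classical
  simp only [expect, PMF.pure_apply]
  rw [Finset.sum_eq_single x] <;> simp +contextual

theorem expect_map (p : PMF Ω) (g : Ω → Ω') (f : Ω' → ℝ) :
    expect (p.map g) f = expect p fun x => f (g x) := by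
  rw [PMF.map, expect_bind]
  simp only [Function.comp, expect_pure]

theorem expect_add (p : PMF Ω) (f g : Ω → ℝ) :
    expect p (fun x => f x + g x) = expect p f + expect p g := by
  simp only [expect, mul_add, Finset.sum_add_distrib]

theorem expect_const_mul (p : PMF Ω) (c : ℝ) (f : Ω → ℝ) :
    expect p (fun x => c * f x) = c * expect p f := by
  simp only [expect, Finset.mul_sum]
  exact Finset.sum_congr rfl fun x _ => by ring

theorem expect_const (p : PMF Ω) (c : ℝ) : expect p (fun _ => c) = c := by
  simp only [expect, ← Finset.sum_mul, sum_toReal, one_mul]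

theorem expect_sum {ι : Type*} (s : Finset ι) (p : PMF Ω) (f : ι → Ω → ℝ) :
    expect p (fun x => ∑ i ∈ s, f i x) = ∑ i ∈ s, expect p (f i) := by
  simp only [expect, Finset.mul_sum]
  exact Finset.sum_comm

theorem expect_ite_eq (p : PMF Ω) (y : Ω) [DecidablePred (· = y)] :
    expect p (fun x => if x = y then 1 else 0) = (p y).toReal := by
  rw [expect, Finset.sum_eq_single y] <;> simp +contextual

theorem expect_mono (p : PMF Ω) {f g : Ω → ℝ} (h : ∀ x, f x ≤ g x) :
    expect p f ≤ expect p g :=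
  Finset.sum_le_sum fun x _ => mul_le_mul_of_nonneg_left (h x) ENNReal.toReal_nonneg

end Expectation

/-! ### Product laws and independence of coordinates. -/

section ProductLaw

variable {ι α : Type*} [Fintype ι] [DecidableEq ι] [Fintype α]

theorem toReal_productLaw (p : ι → PMF α) (x : ι → α) :
    (productLaw p x).toReal = ∏ i, (p i (x i)).toReal := by
  simp [productLaw, ENNReal.toReal_prod]

theorem expect_productLaw_prod (p : ι → PMF α) (f : ι → α → ℝ) :
    expect (productLaw p) (fun x => ∏ i, f i (x i)) = ∏ i, expect (p i) (f i) := by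
  simp only [expect, toReal_productLaw, ← Finset.prod_mul_distrib]
  rw [Fintype.prod_sum]

theorem expect_productLaw_prod_comp {κ : Type*} [Fintype κ] (p : ι → PMF α) {e : κ → ι}
    (he : Function.Injective e) (f : κ → α → ℝ) :
    expect (productLaw p) (fun x => ∏ k, f k (x (e k))) = ∏ k, expect (p (e k)) (f k) := by
  classical
  -- Extending `f` along `e` by the constant `1` reduces the claim to a product over all
  -- coordinates.
  let g : ι → α → ℝ := fun i => if h : ∃ k, e k = i then f h.choose else fun _ => 1
  have hg : ∀ k, g (e k) = f k := fun k => by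
    have h : ∃ k', e k' = e k := ⟨k, rfl⟩
    simp only [g, dif_pos h, he h.choose_spec]
  have hg' : ∀ i ∉ Set.range e, g i = fun _ => 1 := fun i hi => dif_neg hi
  have h1 : ∀ x : ι → α, ∏ k, f k (x (e k)) = ∏ i, g i (x i) := fun x =>
    Fintype.prod_of_injective e he _ _ (fun i hi => by rw [hg' i hi]) fun k => by rw [hg]
  simp only [h1]
  rw [expect_productLaw_prod]
  refine (Fintype.prod_of_injective e he _ _ (fun i hi => ?_) fun k => by rw [hg]).symm
  rw [hg' i hi, expect_const]

theorem eq_sum_mul_prod_ite [DecidableEq α] (F : (ι → α) → ℝ) (y : ι → α) :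
    F y = ∑ y', F y' * ∏ a, if y a = y' a then (1 : ℝ) else 0 := by
  rw [Finset.sum_eq_single y]
  · simp
  · intro b _ hb
    obtain ⟨a, ha⟩ := Function.ne_iff.1 hb.symm
    rw [Finset.prod_eq_zero (Finset.mem_univ a) (if_neg ha), mul_zero]
  · simp

/-- Under a product law, functions of disjoint sets of coordinates are independent. -/
theorem expect_productLaw_mul {κ κ' : Type*} [Fintype κ] [DecidableEq κ] [Fintype κ']
    [DecidableEq κ'] (p : ι → PMF α) {i : κ → ι} {j : κ' → ι} (hi : Function.Injective i)
    (hj : Function.Injective j) (hij : ∀ a b, i a ≠ j b) (F : (κ → α) → ℝ) (G : (κ' → α) → ℝ) :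
    expect (productLaw p) (fun x => F (fun a => x (i a)) * G (fun b => x (j b))) =
      expect (productLaw fun a => p (i a)) F * expect (productLaw fun b => p (j b)) G := by
  classical
  have he : Function.Injective (Sum.elim i j) := Function.Injective.sumElim hi hj hij
  -- By bilinearity it suffices to treat indicators of single configurations, which are products
  -- over coordinates.
  have key : ∀ (y : κ → α) (z : κ' → α),
      expect (productLaw p) (fun x => (∏ a, if x (i a) = y a then (1 : ℝ) else 0) *
        ∏ b, if x (j b) = z b then (1 : ℝ) else 0) =
      (∏ a, (p (i a) (y a)).toReal) * ∏ b, (p (j b) (z b)).toReal := by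
    intro y z
    have h1 := expect_productLaw_prod_comp p he
      (fun k c => if c = Sum.elim y z k then (1 : ℝ) else 0)
    simp only [Fintype.prod_sum_type, Sum.elim_inl, Sum.elim_inr] at h1
    exact h1.trans (congrArg₂ (· * ·)
      (Finset.prod_congr rfl fun a _ => expect_ite_eq _ _)
      (Finset.prod_congr rfl fun b _ => expect_ite_eq _ _))
  have h2 : ∀ x : ι → α, F (fun a => x (i a)) * G (fun b => x (j b)) =
      ∑ y, ∑ z, (F y * G z) * ((∏ a, if x (i a) = y a then (1 : ℝ) else 0) *
        ∏ b, if x (j b) = z b then (1 : ℝ) else 0) := by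
    intro x
    rw [eq_sum_mul_prod_ite F, eq_sum_mul_prod_ite G, Finset.sum_mul_sum]
    exact Finset.sum_congr rfl fun y _ => Finset.sum_congr rfl fun z _ => by ring
  simp only [h2, expect_sum, expect_const_mul, key]
  simp only [expect, toReal_productLaw, Finset.sum_mul_sum]
  exact Finset.sum_congr rfl fun y _ => Finset.sum_congr rfl fun z _ => by ring

theorem expect_productLaw_comp {κ : Type*} [Fintype κ] [DecidableEq κ] (p : ι → PMF α)
    {i : κ → ι} (hi : Function.Injective i) (F : (κ → α) → ℝ) :
    expect (productLaw p) (fun x => F (fun a => x (i a))) =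
      expect (productLaw fun a => p (i a)) F := by
  have h := expect_productLaw_mul p hi (j := Empty.elim) (fun a => a.elim) (fun _ b => b.elim) F
    (fun _ => 1)
  simpa only [mul_one, expect_const] using h

theorem expect_productLaw_eval (p : ι → PMF α) (i : ι) (f : α → ℝ) :
    expect (productLaw p) (fun x => f (x i)) = expect (p i) f := by
  have h := expect_productLaw_prod_comp p (e := fun _ : Unit => i)
    (fun _ _ _ => rfl) (fun _ => f)
  simpa using h

end ProductLaw

/-! ### Conditional laws. -/

section CondLaw

/-- The conditional law is given by the quotient of the joint and the marginal weights. -/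
theorem toReal_condLaw {α β : Type*} [Fintype β] (J : PMF (α × β)) (a : α) (b : β)
    (h : ∑ b', (J (a, b')).toReal ≠ 0) :
    (condLaw J a b).toReal = (J (a, b)).toReal / ∑ b', (J (a, b')).toReal := by
  classical
  have hex : ∃ x ∈ {x : α × β | x.1 = a}, x ∈ J.support := by
    obtain ⟨b', -, hb'⟩ := Finset.exists_ne_zero_of_sum_ne_zero h
    refine ⟨(a, b'), rfl, ?_⟩
    rw [PMF.mem_support_iff]
    intro h0
    exact hb' (by rw [h0, ENNReal.toReal_zero])
  have hind : ∀ F : α × β → ENNReal, ∑' x, ({x : α × β | x.1 = a}.indicator F) x =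
      ∑ b', F (a, b') := by
    intro F
    have hinj : Function.Injective fun b' : β => (a, b') := fun x y hxy => by simpa using hxy
    rw [← tsum_fintype (L := .unconditional _), ← hinj.tsum_eq]
    · exact tsum_congr fun b' => Set.indicator_of_mem (by simp) _
    · intro x hx
      have : x.1 = a := Set.mem_of_indicator_ne_zero (s := {x : α × β | x.1 = a}) hx
      exact ⟨x.2, by rw [← this]⟩
  have hmap : condLaw J a b = J (a, b) * (∑ b', J (a, b'))⁻¹ := by
    rw [condLaw, dif_pos hex, PMF.map_apply, tsum_eq_single (a, b)]
    · rw [if_pos rfl, PMF.filter_apply, hind, Set.indicator_of_mem (by simp)]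
    · rintro ⟨a', b'⟩ hne
      split_ifs with hb
      · rw [PMF.filter_apply_eq_zero_of_notMem]
        rintro (rfl : a' = a)
        exact hne (by simp only at hb; rw [hb])
      · rfl
  rw [hmap, ENNReal.toReal_mul, ENNReal.toReal_inv,
    ENNReal.toReal_sum fun x _ => J.apply_ne_top _, div_eq_mul_inv]

end CondLaw

/-! ### Markov property and full support of the broadcast process. -/

section Broadcast

variable {α : Type*} [Fintype α] {d : ℕ} (κ : α → PMF α) (ν : PMF α)

/-- The parent of a leaf of a subtree lies in the same subtree; this lets the Markov property be
proved by induction on the depth `w`. -/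
theorem init_append {n w : ℕ} (u : Node d n) (t : Node d (w + 1)) :
    (Fin.init (Fin.append u t : Fin (n + (w + 1)) → Fin d) : Fin (n + w) → Fin d) =
      Fin.append u (Fin.init t) := by
  ext i
  refine Fin.addCases (fun a => ?_) (fun b => ?_) i
  · rw [Fin.append_left, Fin.init]
    exact congrArg Fin.val (Fin.append_left u t a)
  · rw [Fin.append_right, Fin.init]
    exact congrArg Fin.val (Fin.append_right u t b.castSucc)

theorem append_injective {n w : ℕ} (u : Node d n) :
    Function.Injective (Fin.append u : Node d w → Node d (n + w)) := fun s t h => by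
  have := (Fin.appendEquiv n w).injective (a₁ := (u, s)) (a₂ := (u, t)) h
  exact (Prod.ext_iff.1 this).2

theorem append_ne_append {n w : ℕ} {u v : Node d n} (huv : u ≠ v) (s t : Node d w) :
    Fin.append u s ≠ Fin.append v t := fun h => by
  have := (Fin.appendEquiv n w).injective (a₁ := (u, s)) (a₂ := (v, t)) h
  exact huv (Prod.ext_iff.1 this).1

theorem expect_broadcast_succ (ℓ : ℕ) (F : (Node d (ℓ + 1) → α) → ℝ) :
    expect (broadcast d κ ν (ℓ + 1)) F = expect (broadcast d κ ν ℓ) fun X =>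
      expect (productLaw fun r : Node d (ℓ + 1) => κ (X (Fin.init r))) F := by
  rw [broadcast, expect_bind]

/-- Markov property of the broadcast process: given level `n`, the leaves of the subtrees rooted
at two different nodes of that level are independent broadcast processes. -/
theorem expect_broadcast_subtree_mul {n w : ℕ} {u v : Node d n} (huv : u ≠ v)
    (F G : (Node d w → α) → ℝ) :
    expect (broadcast d κ ν (n + w)) (fun X => F (subtree X u) * G (subtree X v)) =
      expect (broadcast d κ ν n) fun X => expect (broadcast d κ (PMF.pure (X u)) w) F *
        expect (broadcast d κ (PMF.pure (X v)) w) G := by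
  induction w with
  | zero =>
    simp only [broadcast, expect_map, expect_pure]
    congr 1
    ext X
    congr 2
    · ext t
      exact congrArg X (by rw [Subsingleton.elim t Fin.elim0]; exact Fin.append_elim0 u)
    · ext t
      exact congrArg X (by rw [Subsingleton.elim t Fin.elim0]; exact Fin.append_elim0 v)
  | succ w ih =>
    simp only [expect_broadcast_succ κ _ w]
    rw [← ih]
    change expect (broadcast d κ ν (n + w + 1)) _ = _
    rw [expect_broadcast_succ]
    congr 1
    ext X
    -- Given the level above, the leaves are independent, and the two subtrees occupy disjoint sets
    -- of leaves.
    have h := expect_productLaw_mul (fun r : Node d (n + w + 1) => κ (X (Fin.init r)))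
      (append_injective (w := w + 1) u) (append_injective (w := w + 1) v)
      (append_ne_append huv) F G
    refine h.trans ?_
    congr 2
    · congr 1
      ext1 t
      exact congrArg (fun r => κ (X r)) (init_append u t)
    · congr 1
      ext1 t
      exact congrArg (fun r => κ (X r)) (init_append v t)

theorem expect_broadcast_subtree {n w : ℕ} (u : Node d n) (F : (Node d w → α) → ℝ) :
    expect (broadcast d κ ν (n + w)) (fun X => F (subtree X u)) =
      expect (broadcast d κ ν n) fun X => expect (broadcast d κ (PMF.pure (X u)) w) F := by
  induction w with
  | zero =>
    simp only [broadcast, expect_map, expect_pure]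
    congr 1
    ext X
    congr 1
    ext t
    exact congrArg X (by rw [Subsingleton.elim t Fin.elim0]; exact Fin.append_elim0 u)
  | succ w ih =>
    simp only [expect_broadcast_succ κ _ w]
    rw [← ih]
    change expect (broadcast d κ ν (n + w + 1)) _ = _
    rw [expect_broadcast_succ]
    congr 1
    ext X
    have h := expect_productLaw_comp (fun r : Node d (n + w + 1) => κ (X (Fin.init r)))
      (append_injective (w := w + 1) u) F
    refine h.trans ?_
    congr 2
    ext1 t
    exact congrArg (fun r => κ (X r)) (init_append u t)

theorem broadcast_eq_bind_pure (h : ℕ) :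
    broadcast d κ ν h = ν.bind fun σ => broadcast d κ (PMF.pure σ) h := by
  induction h with
  | zero => simp only [broadcast, PMF.pure_map]; rfl
  | succ h ih => simp only [broadcast]; rw [ih, PMF.bind_bind]

theorem broadcast_apply_ne_zero (hκ : ∀ a b, κ a b ≠ 0) (hν : ∀ a, ν a ≠ 0) (h : ℕ)
    (X : Node d h → α) : broadcast d κ ν h X ≠ 0 := by
  rw [← PMF.mem_support_iff]
  cases h with
  | zero =>
    rw [broadcast, PMF.support_map]
    refine ⟨X Fin.elim0, (PMF.mem_support_iff _ _).2 (hν _), ?_⟩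
    ext t
    exact congrArg X (Subsingleton.elim _ _)
  | succ h =>
    obtain ⟨Y, hY⟩ := (broadcast d κ ν h).support_nonempty
    rw [broadcast, PMF.mem_support_bind_iff]
    refine ⟨Y, hY, ?_⟩
    rw [PMF.mem_support_iff, productLaw, PMF.ofFintype_apply]
    exact Finset.prod_ne_zero_iff.2 fun r _ => hκ _ _

end Broadcast

/-! ### Heights of least common ancestors. -/

section Lca

variable {d n : ℕ}

theorem lcaHeight_self (u : Node d n) : lcaHeight u u = 0 := by
  simp [lcaHeight, Nat.find_eq_zero]

theorem eq_of_lcaHeight_eq_zero {u v : Node d n} (h : lcaHeight u v = 0) : u = v := by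
  rw [lcaHeight, Nat.find_eq_zero] at h
  exact funext fun i => h i (by simp)

theorem lcaHeight_succ {u v : Node d (n + 1)} (huv : u ≠ v) :
    lcaHeight u v = lcaHeight (Fin.init u : Node d n) (Fin.init v) + 1 := by
  have h2 : ∃ k, ∀ i : Fin (n + 1), (i : ℕ) + (k + 1) < n + 1 → u i = v i :=
    ⟨n, fun i hi => absurd hi (by omega)⟩
  refine (Nat.find_comp_succ _ h2
    fun h => huv (funext fun i => h i (by simpa using i.2))).trans ?_
  refine congrArg (· + 1) (Nat.find_congr' fun {k} => ⟨fun h i hi => ?_, fun h i hi => ?_⟩)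
  · exact h i.castSucc (by simp only [Fin.val_castSucc]; omega)
  · exact h ⟨i, by omega⟩ (by simp only; omega)

end Lca

/-! ### Even and odd means, and two-point correlations of blocks. -/

section Ising

variable {d w n : ℕ} {ρ : ℝ} {hρ : ρ ∈ Set.Icc (0 : ℝ) 1}

theorem spin_mul_self (σ : ℤˣ) : ((σ : ℤ) : ℝ) * ((σ : ℤ) : ℝ) = 1 := by
  rcases Int.units_eq_one_or σ with rfl | rfl <;> simp

theorem expect_isingChannel (σ : ℤˣ) (f : ℤˣ → ℝ) :
    expect (isingChannel ρ hρ σ) f =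
      (f 1 + f (-1)) / 2 + ((σ : ℤ) : ℝ) * (ρ * ((f 1 - f (-1)) / 2)) := by
  have h0 := hρ.1
  have h1 := hρ.2
  rw [expect, UnitsInt.univ, Finset.sum_pair (by decide)]
  have h2 : 0 ≤ (1 + ρ) / 2 := by linarith
  have h3 : 0 ≤ (1 - ρ) / 2 := by linarith
  rcases Int.units_eq_one_or σ with rfl | rfl
  · simp only [isingChannel, PMF.ofFintype_apply, if_true,
      if_neg (show ¬(1 : ℤˣ) = -1 by decide), ENNReal.toReal_ofReal h2, ENNReal.toReal_ofReal h3]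
    push_cast
    ring
  · simp only [isingChannel, PMF.ofFintype_apply, if_true,
      if_neg (show ¬(-1 : ℤˣ) = 1 by decide), ENNReal.toReal_ofReal h2, ENNReal.toReal_ofReal h3]
    push_cast
    ring

theorem expect_uniform_spin (f : ℤˣ → ℝ) :
    expect (PMF.uniformOfFintype ℤˣ) f = (f 1 + f (-1)) / 2 := by
  rw [expect, UnitsInt.univ, Finset.sum_pair (by decide)]
  simp
  ring

theorem isingChannel_apply_ne_zero (h0 : 0 < ρ) (h1 : ρ < 1) (σ σ' : ℤˣ) :
    isingChannel ρ hρ σ σ' ≠ 0 := by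
  rw [isingChannel, PMF.ofFintype_apply]
  split_ifs
  · exact (ENNReal.ofReal_pos.2 (by linarith)).ne'
  · exact (ENNReal.ofReal_pos.2 (by linarith)).ne'

/-- The broadcast process started from a uniform spin. -/
abbrev isingBroadcast (d : ℕ) (ρ : ℝ) (hρ : ρ ∈ Set.Icc (0 : ℝ) 1) (h : ℕ) :
    PMF (Node d h → ℤˣ) :=
  broadcast d (isingChannel ρ hρ) (PMF.uniformOfFintype ℤˣ) h

/-- The law of the leaves given the root spin. -/
abbrev leafLaw (d : ℕ) (ρ : ℝ) (hρ : ρ ∈ Set.Icc (0 : ℝ) 1) (w : ℕ) (σ : ℤˣ) :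
    PMF (Node d w → ℤˣ) :=
  broadcast d (isingChannel ρ hρ) (PMF.pure σ) w

theorem expect_isingBroadcast_spin (n : ℕ) (u : Node d n) :
    expect (isingBroadcast d ρ hρ n) (fun X => ((X u : ℤ) : ℝ)) = 0 := by
  induction n with
  | zero =>
    rw [isingBroadcast, broadcast, expect_map, expect_uniform_spin]
    simp
  | succ n ih =>
    rw [isingBroadcast, expect_broadcast_succ]
    have h : ∀ X : Node d n → ℤˣ, expect (productLaw fun r : Node d (n + 1) =>
        isingChannel ρ hρ (X (Fin.init r))) (fun Y => ((Y u : ℤ) : ℝ)) =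
        ρ * ((X (Fin.init u) : ℤ) : ℝ) := fun X => by
      rw [expect_productLaw_eval _ u (fun σ : ℤˣ => ((σ : ℤ) : ℝ)), expect_isingChannel]
      push_cast
      ring
    simp only [h, expect_const_mul, ih, mul_zero]

/-- As long as the two nodes differ, passing to their parents costs a factor `ρ` for each; at the
common ancestor the product of the spins is `1`. -/
theorem expect_isingBroadcast_spin_mul (n : ℕ) (u v : Node d n) :
    expect (isingBroadcast d ρ hρ n) (fun X => ((X u : ℤ) : ℝ) * ((X v : ℤ) : ℝ)) =
      ρ ^ (2 * lcaHeight u v) := by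
  induction n with
  | zero =>
    obtain rfl : u = v := Subsingleton.elim _ _
    simp only [spin_mul_self, expect_const, lcaHeight_self, mul_zero, pow_zero]
  | succ n ih =>
    by_cases huv : u = v
    · subst huv
      simp only [spin_mul_self, expect_const, lcaHeight_self, mul_zero, pow_zero]
    rw [isingBroadcast, expect_broadcast_succ]
    have h : ∀ X : Node d n → ℤˣ, expect (productLaw fun r : Node d (n + 1) =>
        isingChannel ρ hρ (X (Fin.init r))) (fun Y => ((Y u : ℤ) : ℝ) * ((Y v : ℤ) : ℝ)) =
        ρ ^ 2 * (((X (Fin.init u) : ℤ) : ℝ) * ((X (Fin.init v) : ℤ) : ℝ)) := fun X => by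
      have h1 := expect_productLaw_mul (fun r : Node d (n + 1) =>
        isingChannel ρ hρ (X (Fin.init r))) (i := fun _ : Unit => u) (j := fun _ : Unit => v)
        (fun _ _ _ => rfl) (fun _ _ _ => rfl) (fun _ _ => huv)
        (fun y => ((y () : ℤ) : ℝ)) (fun y => ((y () : ℤ) : ℝ))
      refine h1.trans ?_
      rw [expect_productLaw_eval _ () (fun σ : ℤˣ => ((σ : ℤ) : ℝ)),
        expect_productLaw_eval _ () (fun σ : ℤˣ => ((σ : ℤ) : ℝ)),
        expect_isingChannel, expect_isingChannel]
      push_cast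
      ring
    simp only [h, expect_const_mul]
    rw [ih, lcaHeight_succ huv]
    ring

/-- The mean of `φ` over the leaves of the broadcast process with a uniform root spin. -/
def evenMean (d : ℕ) (ρ : ℝ) (hρ : ρ ∈ Set.Icc (0 : ℝ) 1) (w : ℕ)
    (φ : (Node d w → ℤˣ) → ℝ) : ℝ :=
  (expect (leafLaw d ρ hρ w 1) φ + expect (leafLaw d ρ hρ w (-1)) φ) / 2

/-- Half the difference of the means of `φ` given the two values of the root spin. -/
def oddMean (d : ℕ) (ρ : ℝ) (hρ : ρ ∈ Set.Icc (0 : ℝ) 1) (w : ℕ)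
    (φ : (Node d w → ℤˣ) → ℝ) : ℝ :=
  (expect (leafLaw d ρ hρ w 1) φ - expect (leafLaw d ρ hρ w (-1)) φ) / 2

/-- The weight of a configuration in `evenMean`. -/
def evenWeight (d : ℕ) (ρ : ℝ) (hρ : ρ ∈ Set.Icc (0 : ℝ) 1) (w : ℕ)
    (y : Node d w → ℤˣ) : ℝ :=
  ((leafLaw d ρ hρ w 1 y).toReal + (leafLaw d ρ hρ w (-1) y).toReal) / 2

/-- The weight of a configuration in `oddMean`. -/
def oddWeight (d : ℕ) (ρ : ℝ) (hρ : ρ ∈ Set.Icc (0 : ℝ) 1) (w : ℕ)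
    (y : Node d w → ℤˣ) : ℝ :=
  ((leafLaw d ρ hρ w 1 y).toReal - (leafLaw d ρ hρ w (-1) y).toReal) / 2

/-- The posterior mean of the root spin given the leaves. -/
def posteriorMean (d : ℕ) (ρ : ℝ) (hρ : ρ ∈ Set.Icc (0 : ℝ) 1) (w : ℕ)
    (y : Node d w → ℤˣ) : ℝ :=
  oddWeight d ρ hρ w y / evenWeight d ρ hρ w y

theorem evenMean_eq_sum (φ : (Node d w → ℤˣ) → ℝ) :
    evenMean d ρ hρ w φ = ∑ y, evenWeight d ρ hρ w y * φ y := by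
  simp only [evenMean, evenWeight, expect]
  rw [← Finset.sum_add_distrib, Finset.sum_div]
  exact Finset.sum_congr rfl fun y _ => by ring

theorem oddMean_eq_sum (φ : (Node d w → ℤˣ) → ℝ) :
    oddMean d ρ hρ w φ = ∑ y, oddWeight d ρ hρ w y * φ y := by
  simp only [oddMean, oddWeight, expect]
  rw [← Finset.sum_sub_distrib, Finset.sum_div]
  exact Finset.sum_congr rfl fun y _ => by ring

theorem evenWeight_nonneg (y : Node d w → ℤˣ) : 0 ≤ evenWeight d ρ hρ w y :=
  div_nonneg (add_nonneg ENNReal.toReal_nonneg ENNReal.toReal_nonneg) zero_le_two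

theorem abs_oddWeight_le (y : Node d w → ℤˣ) :
    |oddWeight d ρ hρ w y| ≤ evenWeight d ρ hρ w y := by
  have h1 : 0 ≤ (leafLaw d ρ hρ w 1 y).toReal := ENNReal.toReal_nonneg
  have h2 : 0 ≤ (leafLaw d ρ hρ w (-1) y).toReal := ENNReal.toReal_nonneg
  rw [oddWeight, evenWeight, abs_le]
  constructor <;> linarith

theorem abs_posteriorMean_le_one (y : Node d w → ℤˣ) : |posteriorMean d ρ hρ w y| ≤ 1 := by
  rw [posteriorMean, abs_div, abs_of_nonneg (evenWeight_nonneg y)]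
  exact div_le_one_of_le₀ (abs_oddWeight_le y) (evenWeight_nonneg y)

/-- A zero denominator in `posteriorMean` is harmless, because `|oddWeight| ≤ evenWeight`. -/
theorem evenWeight_mul_posteriorMean (y : Node d w → ℤˣ) :
    evenWeight d ρ hρ w y * posteriorMean d ρ hρ w y = oddWeight d ρ hρ w y := by
  by_cases h : evenWeight d ρ hρ w y = 0
  · have := abs_oddWeight_le (hρ := hρ) y
    rw [h, zero_mul]
    exact (abs_nonpos_iff.1 (h ▸ this)).symm
  · exact mul_div_cancel₀ _ h

theorem evenMean_mul_posteriorMean (φ : (Node d w → ℤˣ) → ℝ) :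
    evenMean d ρ hρ w (fun y => φ y * posteriorMean d ρ hρ w y) = oddMean d ρ hρ w φ := by
  rw [evenMean_eq_sum, oddMean_eq_sum]
  refine Finset.sum_congr rfl fun y _ => ?_
  rw [← evenWeight_mul_posteriorMean]
  ring

/-- Every function of a spin `σ = ±1` is affine in `σ`. -/
theorem expect_leafLaw (σ : ℤˣ) (φ : (Node d w → ℤˣ) → ℝ) :
    expect (leafLaw d ρ hρ w σ) φ =
      evenMean d ρ hρ w φ + ((σ : ℤ) : ℝ) * oddMean d ρ hρ w φ := by
  rw [evenMean, oddMean]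
  rcases Int.units_eq_one_or σ with rfl | rfl
  · push_cast; ring
  · push_cast; ring

theorem expect_isingBroadcast (φ : (Node d w → ℤˣ) → ℝ) :
    expect (isingBroadcast d ρ hρ w) φ = evenMean d ρ hρ w φ := by
  rw [isingBroadcast, broadcast_eq_bind_pure, expect_bind, expect_uniform_spin, evenMean]

theorem toReal_isingBroadcast (y : Node d w → ℤˣ) :
    (isingBroadcast d ρ hρ w y).toReal = evenWeight d ρ hρ w y := by
  rw [isingBroadcast, broadcast_eq_bind_pure, toReal_bind, expect_uniform_spin, evenWeight]

/-- Guarantees that conditioning on a block is never conditioning on a null event, so the default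
branch of `condLaw` plays no role. -/
theorem evenWeight_pos (h0 : 0 < ρ) (h1 : ρ < 1) (y : Node d w → ℤˣ) :
    0 < evenWeight d ρ hρ w y := by
  rw [← toReal_isingBroadcast]
  refine ENNReal.toReal_pos ?_ (PMF.apply_ne_top _ _)
  exact broadcast_apply_ne_zero _ _ (isingChannel_apply_ne_zero h0 h1) (fun σ => by simp) _ _

theorem evenMean_ite_eq (y : Node d w → ℤˣ) [DecidablePred (· = y)] :
    evenMean d ρ hρ w (fun x => if x = y then 1 else 0) = evenWeight d ρ hρ w y := by
  rw [evenMean, expect_ite_eq, expect_ite_eq, evenWeight]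

theorem oddMean_ite_eq (y : Node d w → ℤˣ) [DecidablePred (· = y)] :
    oddMean d ρ hρ w (fun x => if x = y then 1 else 0) = oddWeight d ρ hρ w y := by
  rw [oddMean, expect_ite_eq, expect_ite_eq, oddWeight]

theorem expect_isingBroadcast_subtree (u : Node d n) (F : (Node d w → ℤˣ) → ℝ) :
    expect (isingBroadcast d ρ hρ (n + w)) (fun X => F (subtree X u)) = evenMean d ρ hρ w F := by
  rw [isingBroadcast, expect_broadcast_subtree]
  simp only [expect_leafLaw, expect_add, expect_const, mul_comm _ (oddMean d ρ hρ w F),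
    expect_const_mul]
  rw [expect_isingBroadcast_spin, mul_zero, add_zero]

/-- Given the two root spins the blocks are independent with affine conditional means; only the
constant and the product of the two spins survive averaging. -/
theorem expect_isingBroadcast_subtree_mul {u v : Node d n} (huv : u ≠ v)
    (F G : (Node d w → ℤˣ) → ℝ) :
    expect (isingBroadcast d ρ hρ (n + w)) (fun X => F (subtree X u) * G (subtree X v)) =
      evenMean d ρ hρ w F * evenMean d ρ hρ w G +
        ρ ^ (2 * lcaHeight u v) * (oddMean d ρ hρ w F * oddMean d ρ hρ w G) := by
  rw [isingBroadcast, expect_broadcast_subtree_mul _ _ huv]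
  have h : ∀ X : Node d n → ℤˣ, expect (leafLaw d ρ hρ w (X u)) F *
      expect (leafLaw d ρ hρ w (X v)) G =
      evenMean d ρ hρ w F * evenMean d ρ hρ w G +
      (oddMean d ρ hρ w F * evenMean d ρ hρ w G * ((X u : ℤ) : ℝ) +
      (evenMean d ρ hρ w F * oddMean d ρ hρ w G * ((X v : ℤ) : ℝ) +
      oddMean d ρ hρ w F * oddMean d ρ hρ w G * (((X u : ℤ) : ℝ) * ((X v : ℤ) : ℝ)))) := by
    intro X
    rw [expect_leafLaw, expect_leafLaw]
    ring
  simp only [h, expect_add, expect_const, expect_const_mul]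
  rw [expect_isingBroadcast_spin, expect_isingBroadcast_spin, expect_isingBroadcast_spin_mul]
  ring

end Ising

/-! ### The transition kernel between consecutive blocks. -/

section NextBlock

variable {d w n : ℕ} {ρ : ℝ} {hρ : ρ ∈ Set.Icc (0 : ℝ) 1}

/-- The height of the least common ancestor of the `s`-th pair of adjacent nodes. -/
def adjacentHeight (d n : ℕ) (s : Fin (d ^ n - 1)) : ℕ :=
  lcaHeight (nodeEquiv d n ⟨s, by omega⟩) (nodeEquiv d n ⟨s + 1, by omega⟩)

theorem nodeEquiv_ne_succ (s : Fin (d ^ n - 1)) :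
    nodeEquiv d n ⟨s, by omega⟩ ≠ nodeEquiv d n ⟨s + 1, by omega⟩ := fun h => by
  have := congrArg Fin.val ((nodeEquiv d n).injective h)
  simp at this

theorem one_le_adjacentHeight (s : Fin (d ^ n - 1)) : 1 ≤ adjacentHeight d n s :=
  Nat.one_le_iff_ne_zero.2 fun h => nodeEquiv_ne_succ s (eq_of_lcaHeight_eq_zero h)

theorem nonempty_adjacent (hn : 1 < d ^ n) : Nonempty (Fin (d ^ n - 1)) := ⟨⟨0, by omega⟩⟩

/-- The position of a uniformly random pair of adjacent nodes. -/
def adjacentPosition (d n : ℕ) (hn : 1 < d ^ n) : PMF (Fin (d ^ n - 1)) :=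
  haveI := nonempty_adjacent hn
  PMF.uniformOfFintype (Fin (d ^ n - 1))

theorem adjacentPosition_pos (hn : 1 < d ^ n) (s : Fin (d ^ n - 1)) :
    0 < (adjacentPosition d n hn s).toReal := by
  have := nonempty_adjacent hn
  refine ENNReal.toReal_pos ?_ (PMF.apply_ne_top _ _)
  simp [adjacentPosition]

/-- The mean correlation of the root spins of a random pair of adjacent blocks. -/
def adjacentCorrelation (d n : ℕ) (hn : 1 < d ^ n) (ρ : ℝ) : ℝ :=
  expect (adjacentPosition d n hn) fun s => ρ ^ (2 * adjacentHeight d n s)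

theorem adjacentCorrelation_nonneg (hn : 1 < d ^ n) (ρ : ℝ) :
    0 ≤ adjacentCorrelation d n hn ρ :=
  Finset.sum_nonneg (s := Finset.univ) fun s _ => mul_nonneg ENNReal.toReal_nonneg
    ((even_two_mul (adjacentHeight d n s)).pow_nonneg ρ)

theorem adjacentCorrelation_le (hn : 1 < d ^ n) (hρ : ρ ∈ Set.Icc (0 : ℝ) 1) :
    adjacentCorrelation d n hn ρ ≤ ρ ^ 2 := by
  rw [← expect_const (adjacentPosition d n hn) (ρ ^ 2)]
  refine expect_mono _ fun s => pow_le_pow_of_le_one hρ.1 hρ.2 ?_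
  have := one_le_adjacentHeight s
  omega

theorem adjacentPairLaw_eq {α : Type*} [Fintype α] (κ : α → PMF α) (ν : PMF α)
    (hn : 1 < d ^ n) : adjacentPairLaw d n w κ ν hn =
      (adjacentPosition d n hn).bind fun s => (broadcast d κ ν (n + w)).map fun X =>
        ((adjacentHeight d n s, subtree X (nodeEquiv d n ⟨s, by omega⟩)),
          subtree X (nodeEquiv d n ⟨s + 1, by omega⟩)) := rfl

theorem adjacentPairLaw_map_height {α : Type*} [Fintype α] (κ : α → PMF α) (ν : PMF α)
    (hn : 1 < d ^ n) : (adjacentPairLaw d n w κ ν hn).map (fun x => x.1.1) =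
      (adjacentPosition d n hn).map (adjacentHeight d n) := by
  rw [adjacentPairLaw_eq, PMF.map_bind]
  simp only [PMF.map_comp]
  rw [PMF.map]
  congr 1
  ext1 s
  exact PMF.map_const _ _

open Classical in
theorem toReal_isingAdjacentPairLaw (hn : 1 < d ^ n) (k : ℕ) (y b : Node d w → ℤˣ) :
    (adjacentPairLaw d n w (isingChannel ρ hρ) (PMF.uniformOfFintype ℤˣ) hn
      ((k, y), b)).toReal =
      expect (adjacentPosition d n hn) (fun s => if adjacentHeight d n s = k then 1 else 0) *
        (evenWeight d ρ hρ w y * evenWeight d ρ hρ w b +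
          ρ ^ (2 * k) * (oddWeight d ρ hρ w y * oddWeight d ρ hρ w b)) := by
  rw [adjacentPairLaw_eq, toReal_bind, mul_comm, ← expect_const_mul]
  congr 1
  ext s
  rw [toReal_map]
  by_cases hk : adjacentHeight d n s = k
  · subst hk
    rw [if_pos rfl, mul_one, ← evenMean_ite_eq y, ← evenMean_ite_eq b, ← oddMean_ite_eq y,
      ← oddMean_ite_eq b, adjacentHeight, ← expect_isingBroadcast_subtree_mul (nodeEquiv_ne_succ s)]
    congr 1
    ext X
    simp only [Prod.mk.injEq, true_and, eq_comm (a := y), eq_comm (a := b), ite_and, ite_mul,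
      one_mul, zero_mul]
  · rw [if_neg hk, mul_zero]
    simp only [Prod.mk.injEq, Ne.symm hk, false_and, if_false, expect_const]

/-- Conditioning on `(k, y)` divides the joint weight by the probability of `k` times `evenWeight
y`. The result is affine in `ρ ^ (2 * k)`, so averaging over `k` leaves only `adjacentCorrelation`.
-/
theorem expect_nextBlock (h0 : 0 < ρ) (h1 : ρ < 1) (hn : 1 < d ^ n) (y : Node d w → ℤˣ)
    (φ : (Node d w → ℤˣ) → ℝ) :
    expect (nextBlock d n w (isingChannel ρ hρ) (PMF.uniformOfFintype ℤˣ) hn y) φ =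
      evenMean d ρ hρ w φ + adjacentCorrelation d n hn ρ *
        (posteriorMean d ρ hρ w y * oddMean d ρ hρ w φ) := by
  classical
  rw [nextBlock, adjacentPairLaw_map_height, PMF.bind_map, expect_bind, adjacentCorrelation,
    mul_comm (expect _ _), ← expect_const_mul]
  conv_rhs => rw [← expect_const (adjacentPosition d n hn) (evenMean d ρ hρ w φ)]
  rw [← expect_add]
  congr 1
  ext s
  set k := adjacentHeight d n s with hk
  set c := expect (adjacentPosition d n hn) (fun s => if adjacentHeight d n s = k then 1 else 0)
    with hc
  -- The height `k` is attained at the position `s` itself, which has positive probability.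
  have hc0 : c ≠ 0 := by
    refine (Finset.sum_pos' (fun s' _ => mul_nonneg ENNReal.toReal_nonneg ?_)
      ⟨s, Finset.mem_univ _, ?_⟩).ne'
    · split_ifs <;> norm_num
    · rw [if_pos hk.symm, mul_one]
      exact adjacentPosition_pos hn s
  have hy := (evenWeight_pos (hρ := hρ) h0 h1 y).ne'
  have he : ∑ b, evenWeight d ρ hρ w b = 1 := by
    simp only [← toReal_isingBroadcast, sum_toReal]
  -- The odd mean of a constant vanishes, so the marginal weight of `y` does not depend on the
  -- height.
  have ho : ∑ b, oddWeight d ρ hρ w b = 0 := by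
    have := oddMean_eq_sum (hρ := hρ) (d := d) (w := w) fun _ => 1
    simpa [oddMean, expect_const] using this.symm
  have hsum : ∑ b, (adjacentPairLaw d n w (isingChannel ρ hρ) (PMF.uniformOfFintype ℤˣ) hn
      ((k, y), b)).toReal = c * evenWeight d ρ hρ w y := by
    simp only [toReal_isingAdjacentPairLaw, ← hc]
    rw [← Finset.mul_sum, Finset.sum_add_distrib, ← Finset.mul_sum, ← Finset.mul_sum,
      ← Finset.mul_sum, he, ho]
    ring
  have hcond : ∀ b, (condLaw (adjacentPairLaw d n w (isingChannel ρ hρ)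
      (PMF.uniformOfFintype ℤˣ) hn) (k, y) b).toReal =
      evenWeight d ρ hρ w b + ρ ^ (2 * k) * posteriorMean d ρ hρ w y * oddWeight d ρ hρ w b := by
    intro b
    rw [toReal_condLaw _ _ _ (by rw [hsum]; exact mul_ne_zero hc0 hy), hsum,
      toReal_isingAdjacentPairLaw, ← hc, posteriorMean]
    field_simp
  rw [Function.comp, expect, evenMean_eq_sum, oddMean_eq_sum]
  simp only [← hk, hcond, add_mul, Finset.sum_add_distrib, Finset.mul_sum, Finset.sum_mul]
  congr 1
  exact Finset.sum_congr rfl fun b _ => by ring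

end NextBlock

/-! ### Global spin flip. -/

section Symmetry

variable {d w : ℕ} {ρ : ℝ} {hρ : ρ ∈ Set.Icc (0 : ℝ) 1}

theorem isingChannel_neg (σ σ' : ℤˣ) :
    isingChannel ρ hρ (-σ) (-σ') = isingChannel ρ hρ σ σ' := by
  simp only [isingChannel, PMF.ofFintype_apply, neg_inj]

theorem expect_leafLaw_neg (σ : ℤˣ) (F : (Node d w → ℤˣ) → ℝ) :
    expect (leafLaw d ρ hρ w (-σ)) F = expect (leafLaw d ρ hρ w σ) fun X => F (-X) := by
  induction w with
  | zero => simp only [leafLaw, broadcast, expect_map, expect_pure]; rfl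
  | succ w ih =>
    simp only [leafLaw, expect_broadcast_succ _ _ w]
    rw [leafLaw] at ih
    rw [ih]
    congr 1
    ext X
    simp only [expect, toReal_productLaw]
    refine Fintype.sum_equiv (Equiv.neg _) _ _ fun Y => ?_
    simp only [Equiv.neg_apply, neg_neg, Pi.neg_apply]
    congr 1
    refine Finset.prod_congr rfl fun r _ => ?_
    rw [← isingChannel_neg, neg_neg]

theorem evenMean_comp_neg (F : (Node d w → ℤˣ) → ℝ) :
    evenMean d ρ hρ w (fun X => F (-X)) = evenMean d ρ hρ w F := by
  rw [evenMean, evenMean, ← expect_leafLaw_neg, ← expect_leafLaw_neg, neg_neg, add_comm]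

theorem oddMean_comp_neg (F : (Node d w → ℤˣ) → ℝ) :
    oddMean d ρ hρ w (fun X => F (-X)) = -oddMean d ρ hρ w F := by
  rw [oddMean, oddMean, ← expect_leafLaw_neg, ← expect_leafLaw_neg, neg_neg]
  ring

theorem evenMean_eq_zero {F : (Node d w → ℤˣ) → ℝ} (hF : ∀ X, F (-X) = -F X) :
    evenMean d ρ hρ w F = 0 := by
  have h := evenMean_comp_neg (hρ := hρ) F
  simp only [hF, evenMean_eq_sum, mul_neg, Finset.sum_neg_distrib] at h
  rw [evenMean_eq_sum]
  linarith

theorem posteriorMean_neg (y : Node d w → ℤˣ) :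
    posteriorMean d ρ hρ w (-y) = -posteriorMean d ρ hρ w y := by
  classical
  have h : (fun x : Node d w → ℤˣ => if -x = y then (1 : ℝ) else 0) =
      fun x => if x = -y then 1 else 0 := by
    ext x
    simp only [neg_eq_iff_eq_neg]
  rw [posteriorMean, posteriorMean, ← evenMean_ite_eq (-y), ← oddMean_ite_eq (-y), ← h,
    evenMean_comp_neg fun x => if x = y then (1 : ℝ) else 0,
    oddMean_comp_neg fun x => if x = y then (1 : ℝ) else 0, evenMean_ite_eq, oddMean_ite_eq,
    neg_div]

theorem spinSum_neg {ι : Type*} [Fintype ι] (X : ι → ℤˣ) : spinSum (-X) = -spinSum X := by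
  simp [spinSum]

end Symmetry

/-! ### Uniform moment bounds for a single block. -/

section Moments

variable {d w : ℕ} {ρ : ℝ} {hρ : ρ ∈ Set.Icc (0 : ℝ) 1}

theorem sum_init (ℓ : ℕ) (f : Node d ℓ → ℝ) :
    ∑ r : Node d (ℓ + 1), f (Fin.init r) = d * ∑ u, f u := by
  rw [← (Fin.snocEquiv fun _ : Fin (ℓ + 1) => Fin d).sum_comp, Fintype.sum_prod_type]
  simp [Fin.snocEquiv]

theorem expect_leafLaw_spinSum (w : ℕ) (σ : ℤˣ) :
    expect (leafLaw d ρ hρ w σ) spinSum = (d * ρ) ^ w * ((σ : ℤ) : ℝ) := by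
  induction w with
  | zero => simp [leafLaw, broadcast, expect_map, expect_pure, spinSum]
  | succ w ih =>
    rw [leafLaw, expect_broadcast_succ]
    have h : ∀ X : Node d w → ℤˣ, expect (productLaw fun r : Node d (w + 1) =>
        isingChannel ρ hρ (X (Fin.init r))) spinSum = d * ρ * spinSum X := fun X => by
      unfold spinSum
      rw [expect_sum]
      have h1 : ∀ r : Node d (w + 1), expect (productLaw fun r : Node d (w + 1) =>
          isingChannel ρ hρ (X (Fin.init r))) (fun Y => ((Y r : ℤ) : ℝ)) =
          ρ * ((X (Fin.init r) : ℤ) : ℝ) := fun r => by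
        rw [expect_productLaw_eval _ r (fun σ : ℤˣ => ((σ : ℤ) : ℝ)), expect_isingChannel]
        push_cast
        ring
      simp only [h1]
      rw [← Finset.mul_sum, sum_init w fun u => ((X u : ℤ) : ℝ)]
      ring
    simp only [h, expect_const_mul]
    rw [leafLaw] at ih
    rw [ih]
    ring

theorem oddMean_spinSum (w : ℕ) : oddMean d ρ hρ w spinSum = (d * ρ) ^ w := by
  rw [oddMean, expect_leafLaw_spinSum, expect_leafLaw_spinSum]
  push_cast
  ring

/-- Uses `exp x ≤ 1 + x + x ^ 2` for `|x| ≤ 1`, then `1 + x ≤ exp x` after averaging over the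
channel. -/
theorem expect_isingChannel_exp_le {s : ℝ} (hs : |s| ≤ 1) (σ : ℤˣ) :
    expect (isingChannel ρ hρ σ) (fun τ => Real.exp (s * ((τ : ℤ) : ℝ))) ≤
      Real.exp (s * ρ * ((σ : ℤ) : ℝ) + s ^ 2) := by
  have hexp : ∀ τ : ℤˣ, Real.exp (s * ((τ : ℤ) : ℝ)) ≤ 1 + s ^ 2 + s * ((τ : ℤ) : ℝ) := by
    intro τ
    have h2 : (s * ((τ : ℤ) : ℝ)) ^ 2 = s ^ 2 := by
      rw [mul_pow, sq ((τ : ℤ) : ℝ), spin_mul_self, mul_one]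
    have h1 : |s * ((τ : ℤ) : ℝ)| ≤ 1 := by
      rw [← sq_le_one_iff_abs_le_one, h2, sq_le_one_iff_abs_le_one]
      exact hs
    have := (abs_le.1 (Real.abs_exp_sub_one_sub_id_le h1)).2
    linarith
  refine (expect_mono _ hexp).trans ?_
  rw [expect_add, expect_const, expect_const_mul, expect_isingChannel]
  push_cast
  have := Real.add_one_le_exp (s * ρ * ((σ : ℤ) : ℝ) + s ^ 2)
  linarith

/-- One generation multiplies the argument by `dρ` at the cost of `s ^ 2` per leaf. -/
theorem expect_broadcast_exp_succ_le (ν : PMF ℤˣ) {s : ℝ} (hs : |s| ≤ 1) (ℓ : ℕ) :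
    expect (broadcast d (isingChannel ρ hρ) ν (ℓ + 1)) (fun X => Real.exp (s * spinSum X)) ≤
      Real.exp (s ^ 2 * d ^ (ℓ + 1)) * expect (broadcast d (isingChannel ρ hρ) ν ℓ)
        (fun X => Real.exp (s * (d * ρ) * spinSum X)) := by
  rw [expect_broadcast_succ, ← expect_const_mul]
  refine expect_mono _ fun X => ?_
  have h1 : (fun Y : Node d (ℓ + 1) → ℤˣ => Real.exp (s * spinSum Y)) =
      fun Y => ∏ r, Real.exp (s * ((Y r : ℤ) : ℝ)) := by
    ext Y
    rw [spinSum, Finset.mul_sum, Real.exp_sum]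
  rw [h1, expect_productLaw_prod _ fun _ (σ : ℤˣ) => Real.exp (s * ((σ : ℤ) : ℝ))]
  refine (Finset.prod_le_prod (fun r _ => Finset.sum_nonneg fun x _ =>
    mul_nonneg ENNReal.toReal_nonneg (Real.exp_pos _).le)
    fun r _ => expect_isingChannel_exp_le hs (X (Fin.init r))).trans ?_
  rw [← Real.exp_sum, ← Real.exp_add, Real.exp_le_exp, Finset.sum_add_distrib,
    sum_init ℓ fun u => s * ρ * ((X u : ℤ) : ℝ), ← Finset.mul_sum, spinSum]
  simp only [Finset.sum_const, Finset.card_univ, Fintype.card_pi, Fintype.card_fin,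
    Finset.prod_const, nsmul_eq_mul]
  push_cast
  exact le_of_eq (by ring)

/-- Above the Kesten–Stigum threshold the normalized spin sums have uniformly bounded exponential
moments. -/
theorem expect_isingBroadcast_exp_le (h0 : 0 < ρ) (hKS : 1 < (d : ℝ) * ρ ^ 2) (ℓ : ℕ) (s : ℝ)
    (hs : |s| * (d * ρ) ^ ℓ ≤ 1) :
    expect (isingBroadcast d ρ hρ ℓ) (fun X => Real.exp (s * spinSum X)) ≤
      Real.exp (1 + (1 - ((d * ρ ^ 2)⁻¹) ^ ℓ) / (1 - (d * ρ ^ 2)⁻¹)) := by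
  set t := ((d : ℝ) * ρ ^ 2)⁻¹ with ht
  have ht1 : t < 1 := inv_lt_one_of_one_lt₀ hKS
  -- Since `ρ ≤ 1`, `dρ ≥ dρ ^ 2 > 1`.
  have hdρ : 1 ≤ (d : ℝ) * ρ := by
    have hd : (0 : ℝ) ≤ d := d.cast_nonneg
    nlinarith [mul_le_mul_of_nonneg_left hρ.2 (mul_nonneg hd hρ.1)]
  induction ℓ generalizing s with
  | zero =>
    simp only [pow_zero, mul_one] at hs
    simp only [pow_zero, sub_self, zero_div, add_zero]
    rw [← expect_const (isingBroadcast d ρ hρ 0) (Real.exp 1)]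
    refine expect_mono _ fun X => Real.exp_le_exp.2 ((le_abs_self _).trans ?_)
    rw [abs_mul]
    have : |spinSum X| = 1 := by
      rw [spinSum, Fintype.sum_unique]
      rcases Int.units_eq_one_or (X default) with h | h <;> rw [h] <;> simp
    rw [this, mul_one]
    exact hs
  | succ ℓ ih =>
    have hpow : (1 : ℝ) ≤ (d * ρ) ^ (ℓ + 1) := one_le_pow₀ hdρ
    have hs1 : |s| ≤ 1 := by nlinarith [abs_nonneg s]
    refine (expect_broadcast_exp_succ_le _ hs1 ℓ).trans ?_
    have h1 := ih (s * (d * ρ)) (by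
      rw [abs_mul, abs_of_nonneg (zero_le_one.trans hdρ), mul_assoc, ← pow_succ']
      exact hs)
    refine (mul_le_mul_of_nonneg_left h1 (Real.exp_pos _).le).trans ?_
    rw [← Real.exp_add, Real.exp_le_exp]
    have hd0 : (0 : ℝ) < d := by
      by_contra h
      have : (d : ℝ) = 0 := le_antisymm (not_lt.1 h) d.cast_nonneg
      rw [this] at hKS
      linarith
    -- The left side equals `s ^ 2 * (dρ) ^ (2 * (ℓ + 1)) * t ^ (ℓ + 1)`. The per-level costs are
    -- thus dominated by a geometric series, convergent because `t < 1`.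
    have h2 : s ^ 2 * d ^ (ℓ + 1) ≤ t ^ (ℓ + 1) := by
      have h3 : s ^ 2 * ((d * ρ) ^ (ℓ + 1)) ^ 2 ≤ 1 := by
        rw [← sq_abs, ← mul_pow]
        exact pow_le_one₀ (mul_nonneg (abs_nonneg _) (zero_le_one.trans hpow)) hs
      rw [ht, inv_pow, ← one_div, le_div_iff₀ (pow_pos (mul_pos hd0 (pow_pos h0 2)) _)]
      refine le_trans (le_of_eq ?_) h3
      ring
    have ht0 : 0 ≤ t := by positivity
    have h4 : t ^ (ℓ + 1) ≤ t ^ ℓ := pow_le_pow_of_le_one ht0 ht1.le (Nat.le_succ ℓ)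
    have h5 : (1 - t ^ (ℓ + 1)) / (1 - t) = (1 - t ^ ℓ) / (1 - t) + t ^ ℓ := by
      have : (1 - t) ≠ 0 := by linarith
      field_simp
      ring
    rw [h5]
    linarith

theorem pow_four_le_exp (x : ℝ) : x ^ 4 ≤ 24 * (Real.exp x + Real.exp (-x)) := by
  have h := Real.pow_div_factorial_le_exp |x| (abs_nonneg x) 4
  have h1 : |x| ^ 4 = x ^ 4 := by rw [← abs_pow, abs_of_nonneg (by positivity)]
  have h2 : Real.exp |x| ≤ Real.exp x + Real.exp (-x) := by
    rcases abs_cases x with ⟨h, _⟩ | ⟨h, _⟩ <;> rw [h]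
    · linarith [Real.exp_pos (-x)]
    · linarith [Real.exp_pos x]
  rw [h1, show ((Nat.factorial 4 : ℕ) : ℝ) = 24 by norm_num [Nat.factorial],
    div_le_iff₀ (by norm_num)] at h
  linarith

/-- The spin sum of a block, normalized by its mean given the root spin. -/
def normalizedSum (d w : ℕ) (ρ : ℝ) (y : Node d w → ℤˣ) : ℝ := spinSum y / (d * ρ) ^ w

theorem normalizedSum_neg (y : Node d w → ℤˣ) :
    normalizedSum d w ρ (-y) = -normalizedSum d w ρ y := by
  rw [normalizedSum, normalizedSum, spinSum_neg, neg_div]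

theorem exists_evenMean_normalizedSum_pow_four_le (h0 : 0 < ρ) (hKS : 1 < (d : ℝ) * ρ ^ 2) :
    ∃ β, ∀ w, evenMean d ρ hρ w (fun y => normalizedSum d w ρ y ^ 4) ≤ β := by
  set t := ((d : ℝ) * ρ ^ 2)⁻¹ with ht
  have ht1 : t < 1 := inv_lt_one_of_one_lt₀ hKS
  have hd : (0 : ℝ) ≤ d := d.cast_nonneg
  have ht0 : 0 ≤ t := by positivity
  have hdρ : 1 ≤ (d : ℝ) * ρ := by
    nlinarith [mul_le_mul_of_nonneg_left hρ.2 (mul_nonneg hd hρ.1)]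
  -- `pow_four_le_exp` gives a factor `24` for each of `exp Z` and `exp (-Z)`, that is, for `s =
  -- ±(dρ) ^ (-w)`.
  refine ⟨48 * Real.exp (1 + 1 / (1 - t)), fun w => ?_⟩
  have hc : (0 : ℝ) < (d * ρ) ^ w := pow_pos (zero_lt_one.trans_le hdρ) _
  have key : ∀ s : ℝ, |s| = ((d * ρ) ^ w)⁻¹ →
      expect (isingBroadcast d ρ hρ w) (fun X => Real.exp (s * spinSum X)) ≤
        Real.exp (1 + 1 / (1 - t)) := fun s hs => by
    refine (expect_isingBroadcast_exp_le h0 hKS w s (by rw [hs, inv_mul_cancel₀ hc.ne'])).trans ?_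
    rw [Real.exp_le_exp]
    have : 0 < 1 - t := by linarith
    have : (1 - t ^ w) / (1 - t) ≤ 1 / (1 - t) := by
      gcongr
      linarith [pow_nonneg ht0 w]
    linarith
  have h1 := key ((d * ρ) ^ w)⁻¹ (abs_of_pos (inv_pos.2 hc))
  have h2 := key (-((d * ρ) ^ w)⁻¹) (by rw [abs_neg, abs_of_pos (inv_pos.2 hc)])
  rw [← expect_isingBroadcast]
  refine (expect_mono _ fun y => pow_four_le_exp _).trans ?_
  rw [expect_const_mul, expect_add]
  have h3 : ∀ y : Node d w → ℤˣ, normalizedSum d w ρ y = ((d * ρ) ^ w)⁻¹ * spinSum y :=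
    fun y => by rw [normalizedSum, div_eq_inv_mul]
  simp only [h3, ← neg_mul]
  linarith

end Moments

/-! ### Recursions for the mixed moments of the partial sums. -/

section BlockMoments

variable {d w n : ℕ} {ρ : ℝ} {hρ : ρ ∈ Set.Icc (0 : ℝ) 1}

theorem evenMean_add (f g : (Node d w → ℤˣ) → ℝ) :
    evenMean d ρ hρ w (fun x => f x + g x) = evenMean d ρ hρ w f + evenMean d ρ hρ w g := by
  simp only [← expect_isingBroadcast, expect_add]

theorem evenMean_const_mul (c : ℝ) (f : (Node d w → ℤˣ) → ℝ) :
    evenMean d ρ hρ w (fun x => c * f x) = c * evenMean d ρ hρ w f := by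
  simp only [← expect_isingBroadcast, expect_const_mul]

theorem evenMean_const (c : ℝ) : evenMean d ρ hρ w (fun _ => c) = c := by
  simp only [← expect_isingBroadcast, expect_const]

theorem evenMean_mono {f g : (Node d w → ℤˣ) → ℝ} (h : ∀ x, f x ≤ g x) :
    evenMean d ρ hρ w f ≤ evenMean d ρ hρ w g := by
  simp only [← expect_isingBroadcast]
  exact expect_mono _ h

theorem abs_evenMean_le {f g : (Node d w → ℤˣ) → ℝ} (h : ∀ x, |f x| ≤ g x) :
    |evenMean d ρ hρ w f| ≤ evenMean d ρ hρ w g := by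
  refine abs_le.2 ⟨?_, evenMean_mono fun x => (abs_le.1 (h x)).2⟩
  have h1 := evenMean_mono (hρ := hρ) fun x => (abs_le.1 (h x)).1
  have h2 := evenMean_const_mul (hρ := hρ) (-1) g
  simp only [neg_mul, one_mul] at h2
  linarith

theorem oddMean_const_mul (c : ℝ) (f : (Node d w → ℤˣ) → ℝ) :
    oddMean d ρ hρ w (fun x => c * f x) = c * oddMean d ρ hρ w f := by
  simp only [oddMean, expect_const_mul]
  ring

/-- The law of the first `m` blocks of the autoregressive Ising process. -/
abbrev isingBlocks (d n w : ℕ) [NeZero d] (ρ : ℝ) (hρ : ρ ∈ Set.Icc (0 : ℝ) 1) (m : ℕ)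
    (hm : m ≤ d ^ n) : PMF (Fin m → (Node d w → ℤˣ)) :=
  blocks d n w (isingChannel ρ hρ) (PMF.uniformOfFintype ℤˣ) m hm

theorem expect_isingBlocks_one [NeZero d] (hm : 1 ≤ d ^ n)
    (F : (Fin 1 → (Node d w → ℤˣ)) → ℝ) :
    expect (isingBlocks d n w ρ hρ 1 hm) F = evenMean d ρ hρ w fun y => F fun _ => y := by
  rw [isingBlocks, blocks, expect_map, ← expect_isingBroadcast_subtree]

theorem expect_isingBlocks_succ [NeZero d] (h0 : 0 < ρ) (h1 : ρ < 1) {m : ℕ}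
    (hm : m + 2 ≤ d ^ n) (F : (Fin (m + 2) → (Node d w → ℤˣ)) → ℝ) :
    expect (isingBlocks d n w ρ hρ (m + 2) hm) F =
      expect (isingBlocks d n w ρ hρ (m + 1) (by omega)) fun Y =>
        evenMean d ρ hρ w (fun y => F (Fin.snoc (α := fun _ => Node d w → ℤˣ) Y y)) +
        adjacentCorrelation d n (by omega) ρ * (posteriorMean d ρ hρ w (Y (Fin.last m)) *
          oddMean d ρ hρ w fun y => F (Fin.snoc (α := fun _ => Node d w → ℤˣ) Y y)) := by
  rw [isingBlocks, blocks, expect_bind]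
  simp only [expect_map, expect_nextBlock h0 h1]

/-- The sum of the normalized spin sums of the blocks. -/
def blockSum (d w : ℕ) (ρ : ℝ) {m : ℕ} (Y : Fin m → (Node d w → ℤˣ)) : ℝ :=
  ∑ r, normalizedSum d w ρ (Y r)

theorem blockSum_snoc {m : ℕ} (Y : Fin m → (Node d w → ℤˣ)) (y : Node d w → ℤˣ) :
    blockSum d w ρ (Fin.snoc (α := fun _ => Node d w → ℤˣ) Y y) =
      blockSum d w ρ Y + normalizedSum d w ρ y := by
  rw [blockSum, Fin.sum_univ_castSucc]
  simp only [Fin.snoc_castSucc, Fin.snoc_last, blockSum]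

theorem blockSum_one (y : Node d w → ℤˣ) :
    blockSum d w ρ (fun _ : Fin 1 => y) = normalizedSum d w ρ y := by
  simp [blockSum]

/-- The mixed moment `𝔼[T ^ j M ^ l]` of the sum `T` of the blocks and the posterior mean `M` of
the root spin of the last block. -/
def blockMoment (d n w : ℕ) [NeZero d] (ρ : ℝ) (hρ : ρ ∈ Set.Icc (0 : ℝ) 1) (m : ℕ)
    (hm : m + 1 ≤ d ^ n) (j l : ℕ) : ℝ :=
  expect (isingBlocks d n w ρ hρ (m + 1) hm) fun Y =>
    blockSum d w ρ Y ^ j * posteriorMean d ρ hρ w (Y (Fin.last m)) ^ l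

theorem blockMoment_zero [NeZero d] (hm : 0 + 1 ≤ d ^ n) (j l : ℕ) :
    blockMoment d n w ρ hρ 0 hm j l = evenMean d ρ hρ w fun y =>
      normalizedSum d w ρ y ^ j * posteriorMean d ρ hρ w y ^ l := by
  rw [blockMoment]
  exact (expect_isingBlocks_one hm _).trans (by simp only [blockSum_one])

/-- The moment `𝔼[Z ^ j M ^ l]` of the normalized sum `Z` of a single block and the posterior mean
`M` of its root spin. -/
def evenMoment (d w : ℕ) (ρ : ℝ) (hρ : ρ ∈ Set.Icc (0 : ℝ) 1) (j l : ℕ) : ℝ :=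
  evenMean d ρ hρ w fun y => normalizedSum d w ρ y ^ j * posteriorMean d ρ hρ w y ^ l

/-- The counterpart of `evenMoment` for `oddMean`. -/
def oddMoment (d w : ℕ) (ρ : ℝ) (hρ : ρ ∈ Set.Icc (0 : ℝ) 1) (j l : ℕ) : ℝ :=
  oddMean d ρ hρ w fun y => normalizedSum d w ρ y ^ j * posteriorMean d ρ hρ w y ^ l

theorem oddMoment_eq_evenMoment (j l : ℕ) :
    oddMoment d w ρ hρ j l = evenMoment d w ρ hρ j (l + 1) := by
  rw [oddMoment, evenMoment, ← evenMean_mul_posteriorMean]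
  simp only [pow_succ, mul_assoc]

theorem evenMoment_eq_zero {j l : ℕ} (h : Odd (j + l)) : evenMoment d w ρ hρ j l = 0 := by
  refine evenMean_eq_zero fun X => ?_
  rw [normalizedSum_neg, posteriorMean_neg, neg_pow, neg_pow (posteriorMean d ρ hρ w X),
    mul_mul_mul_comm, ← pow_add, h.neg_one_pow, neg_one_mul]

/-- `𝔼[Z M]` is the odd mean of `Z`, and the normalization by `(dρ) ^ w` is chosen to make this `1`.
-/
theorem evenMoment_one_one (hc : (d : ℝ) * ρ ≠ 0) : evenMoment d w ρ hρ 1 1 = 1 := by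
  have h : ∀ y : Node d w → ℤˣ, normalizedSum d w ρ y ^ 1 * posteriorMean d ρ hρ w y ^ 0 =
      ((d * ρ) ^ w)⁻¹ * spinSum y := fun y => by
    rw [pow_one, pow_zero, mul_one, normalizedSum, div_eq_inv_mul]
  rw [← oddMoment_eq_evenMoment, oddMoment]
  simp only [h]
  rw [oddMean_const_mul, oddMean_spinSum, inv_mul_cancel₀ (pow_ne_zero _ hc)]

theorem evenMoment_zero_zero : evenMoment d w ρ hρ 0 0 = 1 := by
  simp only [evenMoment, pow_zero, mul_one, evenMean_const]

/-- Adding one block: the binomial expansion of the mixed moments. -/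
theorem blockMoment_succ [NeZero d] (h0 : 0 < ρ) (h1 : ρ < 1) {m : ℕ} (hm : m + 1 + 1 ≤ d ^ n)
    (j l : ℕ) :
    blockMoment d n w ρ hρ (m + 1) hm j l = ∑ i ∈ Finset.range (j + 1),
      (j.choose i : ℝ) *
        (evenMoment d w ρ hρ (j - i) l * blockMoment d n w ρ hρ m (by omega) i 0 +
          adjacentCorrelation d n (by omega) ρ * evenMoment d w ρ hρ (j - i) (l + 1) *
            blockMoment d n w ρ hρ m (by omega) i 1) := by
  rw [blockMoment]
  refine (expect_isingBlocks_succ h0 h1 hm _).trans ?_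
  simp only [blockSum_snoc, Fin.snoc_last]
  have hpow : ∀ (T : ℝ) (y : Node d w → ℤˣ),
      (T + normalizedSum d w ρ y) ^ j * posteriorMean d ρ hρ w y ^ l =
      ∑ i ∈ Finset.range (j + 1), ((j.choose i : ℝ) * T ^ i) *
        (normalizedSum d w ρ y ^ (j - i) * posteriorMean d ρ hρ w y ^ l) := fun T y => by
    rw [add_pow, Finset.sum_mul]
    exact Finset.sum_congr rfl fun i _ => by ring
  have heven : ∀ T : ℝ, evenMean d ρ hρ w (fun y =>
      (T + normalizedSum d w ρ y) ^ j * posteriorMean d ρ hρ w y ^ l) =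
      ∑ i ∈ Finset.range (j + 1), ((j.choose i : ℝ) * T ^ i) * evenMoment d w ρ hρ (j - i) l :=
    fun T => by
      simp only [hpow, evenMoment, ← expect_isingBroadcast, expect_sum, expect_const_mul]
  -- An odd mean is an even mean with one more factor `M`, which raises `l` to `l + 1`.
  have hodd : ∀ T : ℝ, oddMean d ρ hρ w (fun y =>
      (T + normalizedSum d w ρ y) ^ j * posteriorMean d ρ hρ w y ^ l) =
      ∑ i ∈ Finset.range (j + 1), ((j.choose i : ℝ) * T ^ i) *
        evenMoment d w ρ hρ (j - i) (l + 1) :=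
    fun T => by
      simp only [hpow, ← oddMoment_eq_evenMoment, oddMoment, oddMean, expect_sum, expect_const_mul]
      rw [← Finset.sum_sub_distrib, Finset.sum_div]
      exact Finset.sum_congr rfl fun i _ => by ring
  simp only [heven, hodd, Finset.mul_sum]
  rw [expect_add, expect_sum, expect_sum, ← Finset.sum_add_distrib]
  refine Finset.sum_congr rfl fun i _ => ?_
  rw [mul_add, blockMoment, blockMoment]
  congr 1
  · rw [← mul_assoc, ← expect_const_mul]
    congr 1
    ext Y
    ring
  · rw [← mul_assoc, ← expect_const_mul]
    congr 1
    ext Y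
    ring

theorem blockMoment_zero_zero [NeZero d] {m : ℕ} (hm : m + 1 ≤ d ^ n) :
    blockMoment d n w ρ hρ m hm 0 0 = 1 := by
  simp only [blockMoment, pow_zero, mul_one, expect_const]

theorem blockMoment_one_one_succ [NeZero d] (h0 : 0 < ρ) (h1 : ρ < 1) (hc : (d : ℝ) * ρ ≠ 0)
    {m : ℕ} (hm : m + 1 + 1 ≤ d ^ n) :
    blockMoment d n w ρ hρ (m + 1) hm 1 1 = adjacentCorrelation d n (by omega) ρ *
      evenMoment d w ρ hρ 0 2 * blockMoment d n w ρ hρ m (by omega) 1 1 + 1 := by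
  rw [blockMoment_succ h0 h1]
  norm_num [Finset.sum_range_succ, Nat.choose, blockMoment_zero_zero, evenMoment_one_one hc,
    evenMoment_eq_zero (show Odd (1 + 2) by decide),
    evenMoment_eq_zero (show Odd (0 + 1) by decide)]
  ring

theorem blockMoment_two_zero_succ [NeZero d] (h0 : 0 < ρ) (h1 : ρ < 1) (hc : (d : ℝ) * ρ ≠ 0)
    {m : ℕ} (hm : m + 1 + 1 ≤ d ^ n) :
    blockMoment d n w ρ hρ (m + 1) hm 2 0 = blockMoment d n w ρ hρ m (by omega) 2 0 +
      2 * adjacentCorrelation d n (by omega) ρ * blockMoment d n w ρ hρ m (by omega) 1 1 +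
        evenMoment d w ρ hρ 2 0 := by
  rw [blockMoment_succ h0 h1]
  norm_num [Finset.sum_range_succ, Nat.choose, blockMoment_zero_zero, evenMoment_one_one hc,
    evenMoment_zero_zero, evenMoment_eq_zero (show Odd (2 + 1) by decide),
    evenMoment_eq_zero (show Odd (1 + 0) by decide),
    evenMoment_eq_zero (show Odd (0 + 1) by decide)]
  ring

theorem blockMoment_three_one_succ [NeZero d] (h0 : 0 < ρ) (h1 : ρ < 1) (hc : (d : ℝ) * ρ ≠ 0)
    {m : ℕ} (hm : m + 1 + 1 ≤ d ^ n) :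
    blockMoment d n w ρ hρ (m + 1) hm 3 1 = adjacentCorrelation d n (by omega) ρ *
      evenMoment d w ρ hρ 0 2 * blockMoment d n w ρ hρ m (by omega) 3 1 +
      3 * blockMoment d n w ρ hρ m (by omega) 2 0 +
      3 * adjacentCorrelation d n (by omega) ρ * evenMoment d w ρ hρ 2 2 *
        blockMoment d n w ρ hρ m (by omega) 1 1 + evenMoment d w ρ hρ 3 1 := by
  rw [blockMoment_succ h0 h1]
  norm_num [Finset.sum_range_succ, Nat.choose, blockMoment_zero_zero, evenMoment_one_one hc,
    evenMoment_eq_zero (show Odd (3 + 2) by decide),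
    evenMoment_eq_zero (show Odd (2 + 1) by decide),
    evenMoment_eq_zero (show Odd (1 + 2) by decide),
    evenMoment_eq_zero (show Odd (0 + 1) by decide)]
  ring

theorem blockMoment_four_zero_succ [NeZero d] (h0 : 0 < ρ) (h1 : ρ < 1) (hc : (d : ℝ) * ρ ≠ 0)
    {m : ℕ} (hm : m + 1 + 1 ≤ d ^ n) :
    blockMoment d n w ρ hρ (m + 1) hm 4 0 = blockMoment d n w ρ hρ m (by omega) 4 0 +
      4 * adjacentCorrelation d n (by omega) ρ * blockMoment d n w ρ hρ m (by omega) 3 1 +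
      6 * evenMoment d w ρ hρ 2 0 * blockMoment d n w ρ hρ m (by omega) 2 0 +
      4 * adjacentCorrelation d n (by omega) ρ * evenMoment d w ρ hρ 3 1 *
        blockMoment d n w ρ hρ m (by omega) 1 1 + evenMoment d w ρ hρ 4 0 := by
  rw [blockMoment_succ h0 h1]
  norm_num [Finset.sum_range_succ, Nat.choose, blockMoment_zero_zero, evenMoment_one_one hc,
    evenMoment_zero_zero, evenMoment_eq_zero (show Odd (4 + 1) by decide),
    evenMoment_eq_zero (show Odd (3 + 0) by decide),
    evenMoment_eq_zero (show Odd (2 + 1) by decide),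
    evenMoment_eq_zero (show Odd (1 + 0) by decide),
    evenMoment_eq_zero (show Odd (0 + 1) by decide)]
  ring

end BlockMoments

/-! ### Propagation of the cumulant bounds, as a statement about real numbers. -/

section Cumulant

/-- Bounds on the moments of a sum of `k` blocks that amount to `|κ₄| = O(k)` for its fourth
cumulant `F - 3 V ^ 2`. -/
structure MomentBounds (k R K₁ K₂ A B V F : ℝ) : Prop where
  nonneg_A : 0 ≤ A
  A_le : A ≤ R
  le_V : k ≤ V
  abs_B : |B - 3 * A * V| ≤ K₁ * R
  abs_F : |F - 3 * V ^ 2| ≤ K₂ * k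

variable {q θ a b e f r β R : ℝ}

/-- The constant `K₁` of `MomentBounds`. -/
def mixedBound (β R : ℝ) : ℝ := 3 * (β * R) + β + 3 * ((R + 1) * (2 * R + β))

/-- The constant `K₂` of `MomentBounds`. -/
def cumulantBound (β R : ℝ) : ℝ :=
  4 * (β * R) + β + 3 * (2 * R + β) ^ 2 + 4 * (mixedBound β R * R)

theorem momentBounds_one (hR : 1 ≤ R) (ha : 1 ≤ a) (haβ : a ≤ β) (hb : |b| ≤ β) (hf : |f| ≤ β) :
    MomentBounds 1 R (mixedBound β R) (cumulantBound β R) 1 f a b := by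
  have hβ : 1 ≤ β := ha.trans haβ
  have hβR : 1 ≤ β * R := one_le_mul_of_one_le_of_one_le hβ hR
  have hf' := abs_le.1 hf
  have hb' := abs_le.1 hb
  have h1 : (R + 1) * (2 * R + β) ≥ 1 * β := by nlinarith
  have hK : 4 * β ≤ mixedBound β R := by rw [mixedBound]; nlinarith
  have hK0 : 0 ≤ mixedBound β R := by linarith
  have hKR : mixedBound β R ≤ mixedBound β R * R := le_mul_of_one_le_right hK0 hR
  have ha2 : a ^ 2 ≤ (2 * R + β) ^ 2 := by
    apply pow_le_pow_left₀ <;> linarith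
  refine ⟨zero_le_one, hR, ha, abs_le.2 ⟨?_, ?_⟩, abs_le.2 ⟨?_, ?_⟩⟩
  · linarith
  · linarith
  · rw [cumulantBound]; linarith [sq_nonneg a]
  · rw [cumulantBound]; linarith [sq_nonneg a]

/-- Here `a, b, e, f` stand for `𝔼[Z ^ 2]`, `𝔼[Z ^ 4]`, `𝔼[Z ^ 2 M ^ 2]`, `𝔼[Z ^ 3 M]` and `θ` for
`𝔼[M ^ 2]`. Forming `B - 3AV` and `F - 3V ^ 2` cancels every term that grows with `V`. -/
theorem MomentBounds.succ {k A B V F : ℝ} (hq : 0 ≤ q) (hqr : q ≤ r) (hr : r < 1)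
    (hθ : 0 ≤ θ) (hθ1 : θ ≤ 1) (ha : 1 ≤ a) (haβ : a ≤ β) (hb : |b| ≤ β) (he : |e| ≤ β)
    (hf : |f| ≤ β) (hR : R * (1 - r) = 1)
    (h : MomentBounds k R (mixedBound β R) (cumulantBound β R) A B V F) :
    MomentBounds (k + 1) R (mixedBound β R) (cumulantBound β R) (q * θ * A + 1)
      (q * θ * B + 3 * V + 3 * q * e * A + f) (V + 2 * q * A + a)
      (F + 4 * q * B + 6 * a * V + 4 * q * f * A + b) := by
  obtain ⟨hA, hAR, hV, hB, hF⟩ := h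
  have hqθ0 : 0 ≤ q * θ := mul_nonneg hq hθ
  have hqθr : q * θ ≤ r := (mul_le_of_le_one_right hq hθ1).trans hqr
  have hβ : 0 ≤ β := by linarith
  have hR0 : 0 ≤ R := hA.trans hAR
  have hK0 : 0 ≤ mixedBound β R := by rw [mixedBound]; positivity
  have hqA0 : 0 ≤ q * A := mul_nonneg hq hA
  have hqA : q * A ≤ R := (mul_le_of_le_one_left hA (by linarith)).trans hAR
  have hqθA0 : 0 ≤ q * θ * A := mul_nonneg hqθ0 hA
  have hqθA : q * θ * A ≤ r * R := mul_le_mul hqθr hAR hA (hqθ0.trans hqθr)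
  have hqθA' : q * θ * A ≤ R := hqθA.trans (mul_le_of_le_one_left hR0 hr.le)
  have heA : |e * (q * A)| ≤ β * R := by
    rw [abs_mul, abs_of_nonneg hqA0]
    exact mul_le_mul he hqA hqA0 hβ
  have hfA : |f * (q * A)| ≤ β * R := by
    rw [abs_mul, abs_of_nonneg hqA0]
    exact mul_le_mul hf hqA hqA0 hβ
  have hinc0 : 0 ≤ 2 * (q * A) + a := by linarith
  have hinc : 2 * (q * A) + a ≤ 2 * R + β := by linarith
  have hprod0 : 0 ≤ (q * θ * A + 1) * (2 * (q * A) + a) := by positivity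
  have hprod : (q * θ * A + 1) * (2 * (q * A) + a) ≤ (R + 1) * (2 * R + β) := by
    gcongr
  have hsq0 : 0 ≤ (2 * (q * A) + a) ^ 2 := sq_nonneg _
  have hsq : (2 * (q * A) + a) ^ 2 ≤ (2 * R + β) ^ 2 := by gcongr
  have hD : |q * θ * (B - 3 * A * V)| ≤ r * (mixedBound β R * R) := by
    rw [abs_mul, abs_of_nonneg hqθ0]
    exact mul_le_mul hqθr hB (abs_nonneg _) (hqθ0.trans hqθr)
  have hD' : |q * (B - 3 * A * V)| ≤ mixedBound β R * R := by
    rw [abs_mul, abs_of_nonneg hq]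
    exact (mul_le_of_le_one_left (abs_nonneg _) (by linarith)).trans hB
  -- `K₁ * R` is the fixed point of `x ↦ r * x + K₁`, so the bound on `B - 3AV` reproduces itself.
  have hKR : r * (mixedBound β R * R) + mixedBound β R = mixedBound β R * R := by
    linear_combination -mixedBound β R * hR
  have hK₁ : mixedBound β R = 3 * (β * R) + β + 3 * ((R + 1) * (2 * R + β)) := rfl
  have hK₂ : cumulantBound β R =
    4 * (β * R) + β + 3 * (2 * R + β) ^ 2 + 4 * (mixedBound β R * R) := rfl
  rw [abs_le] at heA hfA hD hD' hb hf hF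
  refine ⟨by linarith, by linarith, by linarith, ?_, ?_⟩
  · have : q * θ * B + 3 * V + 3 * q * e * A + f - 3 * (q * θ * A + 1) * (V + 2 * q * A + a) =
        q * θ * (B - 3 * A * V) + 3 * (e * (q * A)) + f -
          3 * ((q * θ * A + 1) * (2 * (q * A) + a)) := by ring
    rw [this]
    exact abs_le.2 ⟨by linarith, by linarith⟩
  · have : F + 4 * q * B + 6 * a * V + 4 * q * f * A + b - 3 * (V + 2 * q * A + a) ^ 2 =
        (F - 3 * V ^ 2) + 4 * (q * (B - 3 * A * V)) + 4 * (f * (q * A)) + b -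
          3 * (2 * (q * A) + a) ^ 2 := by ring
    rw [this, mul_add, mul_one]
    exact abs_le.2 ⟨by linarith, by linarith⟩

end Cumulant

/-! ### From moment bounds to the kurtosis. -/

section Kurtosis

variable {d w n : ℕ} {ρ : ℝ} {hρ : ρ ∈ Set.Icc (0 : ℝ) 1}

/-- `1 = 𝔼[Z M] ≤ (𝔼[Z ^ 2] + 𝔼[M ^ 2]) / 2` and `|M| ≤ 1`. This gives the linear growth of the
variance. -/
theorem one_le_evenMoment_two_zero (hc : (d : ℝ) * ρ ≠ 0) : 1 ≤ evenMoment d w ρ hρ 2 0 := by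
  have h1 : evenMoment d w ρ hρ 1 1 ≤ evenMean d ρ hρ w fun y =>
      (1 / 2) * (normalizedSum d w ρ y ^ 2 * posteriorMean d ρ hρ w y ^ 0) + 1 / 2 := by
    refine evenMean_mono fun y => ?_
    have hm := abs_posteriorMean_le_one (hρ := hρ) y
    rw [← sq_le_one_iff_abs_le_one] at hm
    nlinarith [sq_nonneg (normalizedSum d w ρ y - posteriorMean d ρ hρ w y)]
  rw [evenMoment_one_one hc, evenMean_add, evenMean_const_mul, evenMean_const] at h1
  rw [evenMoment]
  linarith

/-- `|M| ≤ 1` and `|Z| ^ j ≤ Z ^ 4 + 1` for `j ≤ 4`. -/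
theorem abs_evenMoment_le {j : ℕ} (hj : j ≤ 4) (l : ℕ) :
    |evenMoment d w ρ hρ j l| ≤ evenMean d ρ hρ w (fun y => normalizedSum d w ρ y ^ 4) + 1 := by
  rw [← evenMean_const (hρ := hρ) (w := w) (d := d) 1, ← evenMean_add]
  refine abs_evenMean_le fun y => ?_
  rw [abs_mul, abs_pow, abs_pow]
  refine (mul_le_of_le_one_right (by positivity)
    (pow_le_one₀ (abs_nonneg _) (abs_posteriorMean_le_one y))).trans ?_
  rw [← Even.pow_abs (n := 4) (by decide)]
  rcases le_total |normalizedSum d w ρ y| 1 with h | h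
  · exact (pow_le_one₀ (abs_nonneg _) h).trans (le_add_of_nonneg_left (by positivity))
  · exact (pow_le_pow_right₀ h hj).trans (le_add_of_nonneg_right zero_le_one)

theorem evenMoment_zero_two_mem : evenMoment d w ρ hρ 0 2 ∈ Set.Icc (0 : ℝ) 1 := by
  have h : ∀ y : Node d w → ℤˣ, posteriorMean d ρ hρ w y ^ 2 ≤ 1 := fun y =>
    sq_le_one_iff_abs_le_one _ |>.2 (abs_posteriorMean_le_one y)
  constructor
  · rw [evenMoment, ← evenMean_const (hρ := hρ) (w := w) (d := d) 0]
    exact evenMean_mono fun y => by positivity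
  · rw [evenMoment, ← evenMean_const (hρ := hρ) (w := w) (d := d) 1]
    exact evenMean_mono fun y => by rw [pow_zero, one_mul]; exact h y

theorem momentBounds_blockMoment [NeZero d] (h0 : 0 < ρ) (h1 : ρ < 1) {β : ℝ}
    (hβ : evenMean d ρ hρ w (fun y => normalizedSum d w ρ y ^ 4) + 1 ≤ β) {m : ℕ}
    (hm : m + 1 ≤ d ^ n) :
    MomentBounds (m + 1) (1 - ρ ^ 2)⁻¹ (mixedBound β (1 - ρ ^ 2)⁻¹)
      (cumulantBound β (1 - ρ ^ 2)⁻¹) (blockMoment d n w ρ hρ m hm 1 1)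
      (blockMoment d n w ρ hρ m hm 3 1) (blockMoment d n w ρ hρ m hm 2 0)
      (blockMoment d n w ρ hρ m hm 4 0) := by
  have hc : (d : ℝ) * ρ ≠ 0 := mul_ne_zero (Nat.cast_ne_zero.2 (NeZero.ne d)) h0.ne'
  have hr : ρ ^ 2 < 1 := pow_lt_one₀ h0.le h1 two_ne_zero
  have hr' : 0 < 1 - ρ ^ 2 := by linarith
  have ha := one_le_evenMoment_two_zero (hρ := hρ) (w := w) hc
  have hM : ∀ {j : ℕ}, j ≤ 4 → ∀ l, |evenMoment d w ρ hρ j l| ≤ β := fun hj l =>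
    (abs_evenMoment_le hj l).trans hβ
  have haβ := (le_abs_self _).trans (hM (j := 2) (by decide) 0)
  induction m with
  | zero =>
    have h : ∀ j l, blockMoment d n w ρ hρ 0 hm j l = evenMoment d w ρ hρ j l :=
      blockMoment_zero hm
    rw [h, h, h, h, evenMoment_one_one hc, Nat.cast_zero, zero_add]
    exact momentBounds_one ((one_le_inv₀ hr').2 (by linarith [sq_nonneg ρ])) ha haβ
      (hM le_rfl 0) (hM (by decide) 1)
  | succ m ih =>
    rw [blockMoment_one_one_succ h0 h1 hc, blockMoment_two_zero_succ h0 h1 hc,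
      blockMoment_three_one_succ h0 h1 hc, blockMoment_four_zero_succ h0 h1 hc]
    push_cast
    exact MomentBounds.succ (adjacentCorrelation_nonneg _ ρ) (adjacentCorrelation_le _ hρ) hr
      evenMoment_zero_two_mem.1 evenMoment_zero_two_mem.2 ha haβ (hM le_rfl 0)
      (hM (by decide) 2) (hM (by decide) 1) (inv_mul_cancel₀ hr'.ne') (ih (by omega))

theorem spinSum_eq_mul_blockSum (hc : (d : ℝ) * ρ ≠ 0) (Y : Fin (d ^ n) → (Node d w → ℤˣ)) :
    spinSum (fun ℓ : Node d (n + w) => Y ((nodeEquiv d n).symm fun i => ℓ (Fin.castAdd w i))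
      fun j => ℓ (Fin.natAdd n j)) = (d * ρ) ^ w * blockSum d w ρ Y := by
  rw [spinSum, ← (Fin.appendEquiv n w).sum_comp, Fintype.sum_prod_type,
    ← (nodeEquiv d n).sum_comp, blockSum, Finset.mul_sum]
  refine Finset.sum_congr rfl fun r _ => ?_
  rw [normalizedSum, mul_div_cancel₀ _ (pow_ne_zero _ hc), spinSum]
  refine Finset.sum_congr rfl fun t _ => ?_
  simp [Fin.appendEquiv]

theorem excessKurtosis_const_mul {Ω : Type*} [Fintype Ω] (p : PMF Ω) (S : Ω → ℝ) {c : ℝ}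
    (hc : c ≠ 0) : excessKurtosis p (fun x => c * S x) = excessKurtosis p S := by
  simp only [excessKurtosis, mul_pow, expect_const_mul]
  rw [← pow_mul, mul_div_mul_left _ _ (pow_ne_zero _ hc)]

theorem abs_excessKurtosis_blockSum_le [NeZero d] (h0 : 0 < ρ) (h1 : ρ < 1) {β : ℝ}
    (hβ : evenMean d ρ hρ w (fun y => normalizedSum d w ρ y ^ 4) + 1 ≤ β) {N : ℕ} (hN : 0 < N)
    (hNd : N ≤ d ^ n) :
    |excessKurtosis (isingBlocks d n w ρ hρ N hNd) (blockSum d w ρ)| ≤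
      cumulantBound β (1 - ρ ^ 2)⁻¹ / N := by
  obtain ⟨m, rfl⟩ : ∃ m, N = m + 1 := ⟨N - 1, by omega⟩
  obtain ⟨-, -, hV, -, hF⟩ := momentBounds_blockMoment (hρ := hρ) h0 h1 hβ hNd
  have h : excessKurtosis (isingBlocks d n w ρ hρ (m + 1) hNd) (blockSum d w ρ) =
      blockMoment d n w ρ hρ m hNd 4 0 / blockMoment d n w ρ hρ m hNd 2 0 ^ 2 - 3 := by
    simp only [excessKurtosis, blockMoment, pow_zero, mul_one]
  rw [h]
  set V := blockMoment d n w ρ hρ m hNd 2 0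
  set F := blockMoment d n w ρ hρ m hNd 4 0
  have hk : (0 : ℝ) < m + 1 := by positivity
  have hV0 : 0 < V := hk.trans_le hV
  have hdiv : F / V ^ 2 - 3 = (F - 3 * V ^ 2) / V ^ 2 := by field_simp
  rw [hdiv, abs_div, abs_of_pos (pow_pos hV0 2)]
  have hC : 0 ≤ cumulantBound β (1 - ρ ^ 2)⁻¹ :=
    nonneg_of_mul_nonneg_left ((abs_nonneg _).trans hF) hk
  push_cast
  -- The numerator is linear in the number of blocks, the denominator at least quadratic.
  calc |F - 3 * V ^ 2| / V ^ 2 ≤ cumulantBound β (1 - ρ ^ 2)⁻¹ * (m + 1) / (m + 1) ^ 2 := by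
        gcongr
    _ = cumulantBound β (1 - ρ ^ 2)⁻¹ / (m + 1) := by field_simp

theorem excessKurtosis_isingAutoregressive [NeZero d] (h0 : 0 < ρ) :
    excessKurtosis (isingAutoregressive d n w ρ hρ) spinSum =
      excessKurtosis (isingBlocks d n w ρ hρ (d ^ n) le_rfl) (blockSum d w ρ) := by
  have hc : (d : ℝ) * ρ ≠ 0 := mul_ne_zero (Nat.cast_ne_zero.2 (NeZero.ne d)) h0.ne'
  rw [← excessKurtosis_const_mul _ (blockSum d w ρ) (pow_ne_zero w hc), isingAutoregressive,
    autoregressive, excessKurtosis, excessKurtosis, expect_map, expect_map]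
  simp only [spinSum_eq_mul_blockSum hc]

end Kurtosis

end TreeBroadcast

end

theorem theorem2 (d : ℕ) [NeZero d] (ρ : ℝ) (hρ : ρ ∈ Set.Icc (0 : ℝ) 1) (hρ1 : ρ < 1)
    (hKS : 1 < (d : ℝ) * ρ ^ 2) (h w : ℕ → ℕ) (hwh : ∀ i, w i ≤ h i)
    (hw : Tendsto w atTop atTop) (hhw : Tendsto (fun i => h i - w i) atTop atTop) :
    Tendsto
      (fun i => TreeBroadcast.excessKurtosis
        (TreeBroadcast.isingAutoregressive d (h i - w i) (w i) ρ hρ) TreeBroadcast.spinSum)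
      atTop (𝓝 0) := by
  have h0 : 0 < ρ := by
    refine lt_of_le_of_ne hρ.1 fun h => ?_
    rw [← h] at hKS
    norm_num at hKS
  have hd : (1 : ℝ) < d := by
    refine hKS.trans_le (mul_le_of_le_one_right d.cast_nonneg (pow_le_one₀ hρ.1 hρ.2))
  obtain ⟨β, hβ⟩ :=
    TreeBroadcast.exists_evenMean_normalizedSum_pow_four_le (hρ := hρ) h0 hKS
  -- `β + 1` rather than `β`, since `abs_evenMoment_le` bounds all moments by the fourth one plus
  -- `1`.
  refine squeeze_zero_norm (a := fun i =>
    TreeBroadcast.cumulantBound (β + 1) (1 - ρ ^ 2)⁻¹ / (d : ℝ) ^ (h i - w i)) (fun i => ?_) ?_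
  · rw [Real.norm_eq_abs, TreeBroadcast.excessKurtosis_isingAutoregressive h0]
    refine (TreeBroadcast.abs_excessKurtosis_blockSum_le h0 hρ1
      (add_le_add_left (hβ (w i)) 1) (Nat.pow_pos (NeZero.pos d)) le_rfl).trans_eq ?_
    push_cast
    rfl
  · exact ((tendsto_pow_atTop_atTop_of_one_lt hd).comp hhw).const_div_atTop _
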